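/- Let $\mathcal S(\mathbb R)$ be the Schwartz space of complex valued functions of $q\in\mathbb R$, and for $j\ge 0$ let $$\psi_j(q)=\frac{1}{\sqrt{2^j\,j!\,\sqrt\pi}}\,e^{-q^2/2}H_j(q)$$ be the Hermite functions, where $H_0=1$, $H_{j+1}=2qH_j-H_j'$. Let $\mathrm{Pol}(\mathbb R^2,\mathbb C)$ be the complex polynomials in the real coordinates $x,y$, put $z=x+\mathrm i y$, $\bar z=x-\mathrm i y$, and let $$D_s=\mathrm i q\,\partial_y-\partial_x\partial_q=-(q+\partial_q)\partial_z+(q-\partial_q)\partial_{\bar z}$$ be the symplectic Dirac operator on $\mathrm{Pol}(\mathbb R^2,\mathbb C)\otimes\mathcal S(\mathbb R)$. For $h\in\mathbb N_0$ let $M_h$ be the space of solutions of $D_s f=0$ in $\mathrm{Pol}_h(\mathbb R^2,\mathbb C)\otimes\mathcal S(\mathbb R)$ (homogeneity $h$), with the Fréchet topology given by $\mathrm{Pol}_h(\mathbb R^2,\mathbb C)\otimes\mathcal S(\mathbb R)\simeq\mathcal S(\mathbb R)^{h+1}$. A family $(s_k)$ in a subspace $M\subseteq M_h$ is called a topological basis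 of $M$ if each $f\in M$ is the sum of an unconditionally convergent series $f=\sum_k a_k s_k$ with unique coefficients $a_k\in\mathbb C$, and these depend linearly and continuously on $f$. We use $(-1)!!=0!!=1$. Then, for every $h\in\mathbb N_0$: 1. The spinors $$s_{o,k}^h=\sum_{p=0}^h\sqrt{\frac{(2k+2p)!!}{(2k+2p+1)!!}}\binom hp\,\psi_{2k+2p+1}(q)\,\bar z^{\,h-p}z^p,\qquad k\in\mathbb N_0,$$ form a topological basis of the subspace of the elements of $M_h$ that are odd in $q$. 2. The spinors $$s_{e,k}^h=\sum_{p=\max(0,-k)}^h\sqrt{\frac{(2k+2p-1)!!}{(2k+2p)!!}}\binom hp\,\psi_{2k+2p}(q)\,\bar z^{\,h-p}z^p,\qquad k\in\mathbb Z,\ k\ge -h,$$ form a topological basis of the subspace of the elements of $M_h$ that are even in $q$. Moreover, $\operatorname{Ker}(D_s)$ is the direct sum of its odd part and its even part, and each of these is the algebraic direct sum over $h\in\mathbb N_0$ of its subspaces of homogeneity $h$. So the above spinors, for all $h$ and $k$, together describe the whole solution space. -/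

import Mathlib

open scoped TensorProduct SchwartzMap Nat

noncomputable section

namespace SymplecticDirac

/-! ### The Gaussian and the Hermite functions as Schwartz functions -/

theorem abs_pow_mul_exp_le (j : ℕ) (x : ℝ) :
    |x| ^ j * Real.exp (-(x ^ 2 / 2)) ≤ 1 + 2 ^ j * (j ! : ℝ) := by
  have h1 : (x ^ 2 / 2) ^ j / (j ! : ℝ) ≤ Real.exp (x ^ 2 / 2) :=
    Real.pow_div_factorial_le_exp _ (by positivity) j
  have hf : (0 : ℝ) < (j ! : ℝ) := by exact_mod_cast Nat.factorial_pos j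
  have h2 : x ^ (2 * j) ≤ 2 ^ j * (j ! : ℝ) * Real.exp (x ^ 2 / 2) := by
    rw [div_le_iff₀ hf, div_pow, div_le_iff₀ (by positivity), ← pow_mul] at h1
    linarith
  have h3 : |x| ^ j ≤ 1 + x ^ (2 * j) := by
    have e : x ^ (2 * j) = (|x| ^ j) ^ 2 := by
      rw [pow_mul, ← sq_abs, ← pow_mul, ← pow_mul, mul_comm]
    rw [e]
    nlinarith [sq_nonneg (|x| ^ j - 1), pow_nonneg (abs_nonneg x) j]
  have h4 : (1 : ℝ) ≤ Real.exp (x ^ 2 / 2) := Real.one_le_exp (by positivity)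
  rw [Real.exp_neg, ← div_eq_mul_inv, div_le_iff₀ (Real.exp_pos _)]
  nlinarith

theorem poly_mul_exp_le (k : ℕ) (P : Polynomial ℝ) :
    ∃ C : ℝ, ∀ x : ℝ, |x| ^ k * |P.eval x * Real.exp (-(x ^ 2 / 2))| ≤ C := by
  induction P using Polynomial.induction_on' with
  | add p q hp hq =>
    obtain ⟨C, hC⟩ := hp
    obtain ⟨D, hD⟩ := hq
    refine ⟨C + D, fun x => ?_⟩
    rw [Polynomial.eval_add, add_mul]
    have := mul_le_mul_of_nonneg_left
      (abs_add_le (p.eval x * Real.exp (-(x ^ 2 / 2))) (q.eval x * Real.exp (-(x ^ 2 / 2))))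
      (pow_nonneg (abs_nonneg x) k)
    linarith [hC x, hD x]
  | monomial n a =>
    refine ⟨|a| * (1 + 2 ^ (k + n) * ((k + n)! : ℝ)), fun x => ?_⟩
    have := mul_le_mul_of_nonneg_left (abs_pow_mul_exp_le (k + n) x) (abs_nonneg a)
    rw [Polynomial.eval_monomial, abs_mul, abs_mul, abs_pow, Real.abs_exp]
    calc _ = |a| * (|x| ^ (k + n) * Real.exp (-(x ^ 2 / 2))) := by ring
      _ ≤ _ := this

/-- The Gaussian `q ↦ exp (-q² / 2)` as a real Schwartz function. -/
def realGaussian : 𝓢(ℝ, ℝ) where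
  toFun q := Real.exp (-(q ^ 2 / 2))
  smooth' := by fun_prop
  decay' := by
    intro k n
    obtain ⟨C, hC⟩ := poly_mul_exp_le k
      ((-1 : Polynomial ℝ) ^ n * (Polynomial.hermite n).map (Int.castRingHom ℝ))
    refine ⟨C, fun x => ?_⟩
    refine le_trans (le_of_eq ?_) (hC x)
    rw [norm_iteratedFDeriv_eq_norm_iteratedDeriv, iteratedDeriv_eq_iterate,
      Polynomial.deriv_gaussian_eq_hermite_mul_gaussian, Real.norm_eq_abs, Real.norm_eq_abs]
    simp [Polynomial.aeval_def, Polynomial.eval₂_eq_eval_map]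

/-- The Gaussian `q ↦ exp (-q² / 2)` as a complex valued Schwartz function. -/
def gaussian : 𝓢(ℝ, ℂ) := SchwartzMap.postcompCLM Complex.ofRealCLM realGaussian

theorem gaussian_apply (q : ℝ) : gaussian q = (Real.exp (-(q ^ 2 / 2)) : ℝ) := rfl

/-- The (physicists') Hermite polynomials: `H₀ = 1`, `Hₙ₊₁ = 2 X Hₙ - Hₙ'`. -/
def hermitePoly : ℕ → Polynomial ℝ
  | 0 => 1
  | n + 1 => 2 * Polynomial.X * hermitePoly n - Polynomial.derivative (hermitePoly n)

theorem hasTemperateGrowth_poly (P : Polynomial ℝ) :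
    (fun q : ℝ => ((P.eval q : ℝ) : ℂ)).HasTemperateGrowth := by
  induction P using Polynomial.induction_on' with
  | add p q hp hq => simpa using! hp.add hq
  | monomial n a =>
    have h1 : (fun q : ℝ => (q : ℂ)).HasTemperateGrowth := Function.Complex.hasTemperateGrowth_ofReal
    have h2 : (fun _ : ℝ => (a : ℂ)).HasTemperateGrowth := Function.HasTemperateGrowth.const _
    simpa using! h2.mul (h1.pow n)

/-- The Hermite functions `ψₖ(q) = (2ᵏ k! √π)^(-1/2) exp (-q² / 2) Hₖ(q)`. -/
def hermiteFun (k : ℕ) : 𝓢(ℝ, ℂ) :=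
  ((1 / Real.sqrt (2 ^ k * (k ! : ℝ) * Real.sqrt Real.pi) : ℝ) : ℂ) •
    SchwartzMap.smulLeftCLM ℂ (fun q : ℝ => (((hermitePoly k).eval q : ℝ) : ℂ)) gaussian

theorem hermiteFun_apply (k : ℕ) (q : ℝ) :
    hermiteFun k q = ((1 / Real.sqrt (2 ^ k * (k ! : ℝ) * Real.sqrt Real.pi) *
      Real.exp (-(q ^ 2 / 2)) * (hermitePoly k).eval q : ℝ) : ℂ) := by
  simp only [hermiteFun, smul_apply,
    SchwartzMap.smulLeftCLM_apply_apply (hasTemperateGrowth_poly _), gaussian_apply, smul_eq_mul]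
  push_cast
  ring

/-! ### Operators in the variable `q` -/

/-- Multiplication by `q` on `𝓢(ℝ)`. -/
def mulQ : 𝓢(ℝ, ℂ) →ₗ[ℂ] 𝓢(ℝ, ℂ) :=
  (SchwartzMap.smulLeftCLM ℂ (fun q : ℝ => (q : ℂ))).toLinearMap

theorem mulQ_apply (f : 𝓢(ℝ, ℂ)) (q : ℝ) : mulQ f q = q * f q := by
  have h1 : (fun q : ℝ => (q : ℂ)).HasTemperateGrowth := Function.Complex.hasTemperateGrowth_ofReal
  simp [mulQ, SchwartzMap.smulLeftCLM_apply_apply h1]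

/-- Differentiation `∂_q` on `𝓢(ℝ)`. -/
def derivQ : 𝓢(ℝ, ℂ) →ₗ[ℂ] 𝓢(ℝ, ℂ) := (SchwartzMap.derivCLM ℂ ℂ).toLinearMap

/-- The reflection `f(q) ↦ f(-q)` on `𝓢(ℝ)`. -/
def reflectQ : 𝓢(ℝ, ℂ) →ₗ[ℂ] 𝓢(ℝ, ℂ) :=
  (SchwartzMap.compCLMOfContinuousLinearEquiv ℂ (ContinuousLinearEquiv.neg ℝ)).toLinearMap

theorem reflectQ_apply (f : 𝓢(ℝ, ℂ)) (q : ℝ) : reflectQ f q = f (-q) := rfl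

/-! ### Polynomial symplectic spinors on the symplectic plane -/

/-- `Pol(ℝ², ℂ)`, complex polynomials in the real coordinates `x = X 0` and `y = X 1`. -/
abbrev Pol : Type := MvPolynomial (Fin 2) ℂ

/-- The polynomial symplectic spinors `Pol(ℝ², ℂ) ⊗ 𝓢(ℝ)`. -/
abbrev Spinor : Type := Pol ⊗[ℂ] 𝓢(ℝ, ℂ)

/-- The complex coordinate `z = x + i y`. -/
def z : Pol := MvPolynomial.X 0 + MvPolynomial.C Complex.I * MvPolynomial.X 1

/-- The complex coordinate `z̄ = x - i y`. -/
def zbar : Pol := MvPolynomial.X 0 - MvPolynomial.C Complex.I * MvPolynomial.X 1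

/-- The symplectic Dirac operator `D_s = i q ∂_y - ∂_x ∂_q`. -/
def diracOp : Spinor →ₗ[ℂ] Spinor :=
  TensorProduct.map (MvPolynomial.pderiv 1).toLinearMap (Complex.I • mulQ) -
    TensorProduct.map (MvPolynomial.pderiv 0).toLinearMap derivQ

/-- `Pol_h(ℝ², ℂ) ⊗ 𝓢(ℝ)`: the spinors of homogeneity `h` in the variables of the plane. -/
def homogeneousSpinors (h : ℕ) : Submodule ℂ Spinor :=
  LinearMap.range
    (LinearMap.rTensor 𝓢(ℝ, ℂ) (MvPolynomial.homogeneousSubmodule (Fin 2) ℂ h).subtype)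

/-- The spinors that are odd in the variable `q`. -/
def oddSpinors : Submodule ℂ Spinor :=
  LinearMap.ker (LinearMap.lTensor Pol reflectQ + LinearMap.id)

/-- The spinors that are even in the variable `q`. -/
def evenSpinors : Submodule ℂ Spinor :=
  LinearMap.ker (LinearMap.lTensor Pol reflectQ - LinearMap.id)

/-- The odd part of the solution space of the symplectic Dirac operator. -/
def oddMonogenics : Submodule ℂ Spinor := LinearMap.ker diracOp ⊓ oddSpinors

/-- The even part of the solution space of the symplectic Dirac operator. -/
def evenMonogenics : Submodule ℂ Spinor := LinearMap.ker diracOp ⊓ evenSpinors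

/-! ### Topological bases -/

/-- The Schwartz function that multiplies the monomial `x ^ m 0 * y ^ m 1` in a spinor. -/
def coeffAt (m : Fin 2 →₀ ℕ) : Spinor →ₗ[ℂ] 𝓢(ℝ, ℂ) :=
  (TensorProduct.lid ℂ 𝓢(ℝ, ℂ)).toLinearMap ∘ₗ
    LinearMap.rTensor 𝓢(ℝ, ℂ) (MvPolynomial.lcoeff ℂ m)

/-- The topology of convergence in `𝓢(ℝ)` of all the coefficients.  It is used only on subspaces
of `homogeneousSpinors h`; there only `h + 1` coefficients occur, and it is the usual Fréchet
topology of `Pol_h(ℝ², ℂ) ⊗ 𝓢(ℝ) ≃ 𝓢(ℝ) ^ (h + 1)`. -/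
instance spinorTopology : TopologicalSpace Spinor :=
  TopologicalSpace.induced (fun f (m : Fin 2 →₀ ℕ) => coeffAt m f) inferInstance

/-- The family `s` is a topological basis of the subspace `M`, in the sense of an (unconditional)
Schauder basis: its members lie in `M`, and each `f ∈ M` is the sum of a convergent series
`∑ i, a i • s i` for exactly one family `a` of coefficients, each of which depends
linearly and continuously on `f`. -/
def IsTopologicalBasis {ι : Type*} (M : Submodule ℂ Spinor) (s : ι → Spinor) : Prop :=
  (∀ i, s i ∈ M) ∧
    ∃ c : ι → (M →L[ℂ] ℂ), ∀ (f : M) (a : ι → ℂ),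
      HasSum (fun i => a i • s i) (f : Spinor) ↔ ∀ i, a i = c i f

/-! ### The explicit solutions -/

/-- `∑_{p=0}^h √((2k+2p)!! / (2k+2p+1)!!) (h choose p) ψ_{2k+2p+1}(q) z̄^(h-p) z^p`. -/
def oddSolution (h k : ℕ) : Spinor :=
  ∑ p ∈ Finset.range (h + 1),
    ((Real.sqrt (((2 * k + 2 * p)‼ : ℝ) / ((2 * k + 2 * p + 1)‼ : ℝ)) * (h.choose p : ℝ) : ℝ) : ℂ) •
      ((zbar ^ (h - p) * z ^ p) ⊗ₜ[ℂ] hermiteFun (2 * k + 2 * p + 1))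

/-- `√((2m-1)!! / (2m)!!)`, where `(-1)!! = 1`; for `m = 0` the truncated `2 * m - 1` is `0`, and
`0!! = 1` is the value required by this convention. -/
def evenCoeff (m : ℕ) : ℝ := Real.sqrt (((2 * m - 1)‼ : ℝ) / ((2 * m)‼ : ℝ))

/-- `∑_{p=max(0,-k)}^h √((2k+2p-1)!! / (2k+2p)!!) (h choose p) ψ_{2k+2p}(q) z̄^(h-p) z^p` for an
integer `k`; the sum starts at `p = 0` for `k ≥ 0` and at `p = |k|` for `k < 0`, so that
`k + p ≥ 0` in all its terms. -/
def evenSolution (h : ℕ) (k : ℤ) : Spinor :=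
  ∑ p ∈ Finset.Icc (-k).toNat h,
    ((evenCoeff (k + p).toNat * (h.choose p : ℝ) : ℝ) : ℂ) •
      ((zbar ^ (h - p) * z ^ p) ⊗ₜ[ℂ] hermiteFun (2 * (k + p).toNat))

end SymplecticDirac

end

open SymplecticDirac

/-!
The Hermite functions turn the symplectic Dirac equation into a two-term recurrence. In the complex
coordinates the operator is `-(q + ∂_q) ∂_z + (q - ∂_q) ∂_z̄`, so for a homogeneous spinor
`f = ∑ p, f_p z̄^(h-p) z^p` it reads `(h - p) (q - ∂_q) f_p = (p + 1) (q + ∂_q) f_{p+1}`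
(`raiseQ_spinorCoeff_eq`). As `q ± ∂_q` are the ladder operators of the Hermite functions, it
couples the Hermite coefficient of index `j` of `f_p` only with the one of index `j + 2` of `f_{p+1}`. The
pairs `(p, j)` thus fall into chains, labelled by the integer `l = j - 2 p`, along which the
coefficients of a solution are determined by the first one (`matrixCoeff_eq_chainCoeff_mul`); the
solution with coefficients supported on one chain is `chainSolution h l`. Odd spinors involve the
chains with odd `l`, and those with `l < 0` drop out, because such a chain would start with a `ψ₁`
at some `p ≥ 1`, which the equation forces to vanish (`matrixCoeff_succ_one_eq_zero`). Even spinors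
involve all the chains with even `l ≥ -2 h`. These are the two families of the theorem.

What remains is analysis: the Hermite expansion of a Schwartz function converges to it
unconditionally in the Schwartz topology (`hasSum_hermite`). The coefficients decay rapidly, since
`(q + ∂_q) (q - ∂_q)` multiplies the `k`-th one by `2 (k + 1)`, while the Hermite functions grow at
most linearly in `k` (`norm_hermiteFun_le`). The series therefore converges uniformly, and its sum
is the given function because the Hermite functions are complete
(`eq_zero_of_integral_mul_hermiteFun`). Finally every Schwartz seminorm is bounded by a weighted
`ℓ¹` norm of the Hermite coefficients (`exists_seminorm_le_coeffNorm`), and in these norms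
the convergence is plain. Uniqueness and continuity of the expansion coefficients follow from the
orthonormality of the Hermite functions.

The direct sum statements hold because the projections to the homogeneous parts and the
reflection of `q` preserve the kernel of the operator.
-/

open scoped TensorProduct SchwartzMap Nat

noncomputable section

namespace SymplecticDirac

open MeasureTheory Filter Topology

/-! ### Ladder operators -/

/-- The annihilation operator `q + ∂_q`. -/
def lowerQ : 𝓢(ℝ, ℂ) →ₗ[ℂ] 𝓢(ℝ, ℂ) := mulQ + derivQ

/-- The creation operator `q - ∂_q`. -/
def raiseQ : 𝓢(ℝ, ℂ) →ₗ[ℂ] 𝓢(ℝ, ℂ) := mulQ - derivQ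

theorem derivQ_apply (f : 𝓢(ℝ, ℂ)) (q : ℝ) : derivQ f q = deriv f q := rfl

theorem mulQ_eq (f : 𝓢(ℝ, ℂ)) : mulQ f = (1 / 2 : ℂ) • (lowerQ f + raiseQ f) := by
  simp only [lowerQ, raiseQ, LinearMap.add_apply, LinearMap.sub_apply]
  module

theorem derivQ_eq (f : 𝓢(ℝ, ℂ)) : derivQ f = (1 / 2 : ℂ) • (lowerQ f - raiseQ f) := by
  simp only [lowerQ, raiseQ, LinearMap.add_apply, LinearMap.sub_apply]
  module

theorem derivative_hermitePoly_succ (n : ℕ) :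
    Polynomial.derivative (hermitePoly (n + 1)) = (2 * (n + 1) : ℝ) • hermitePoly n := by
  induction n with
  | zero => simp [hermitePoly, Polynomial.smul_eq_C_mul, ← map_ofNat Polynomial.C]
  | succ n ih =>
    have h : hermitePoly (n + 2) =
        2 * Polynomial.X * hermitePoly (n + 1) - Polynomial.derivative (hermitePoly (n + 1)) := rfl
    rw [h, ih]
    simp only [Polynomial.derivative_sub, Polynomial.derivative_mul, Polynomial.derivative_X,
      Polynomial.derivative_smul, ih, Polynomial.derivative_ofNat]
    rw [show hermitePoly (n + 1) =
      2 * Polynomial.X * hermitePoly n - Polynomial.derivative (hermitePoly n) from rfl]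
    simp only [Polynomial.smul_eq_C_mul, map_mul, map_add, map_natCast, map_one, map_ofNat]
    push_cast
    ring

theorem derivative_hermitePoly (n : ℕ) :
    Polynomial.derivative (hermitePoly n) = (2 * n : ℝ) • hermitePoly (n - 1) := by
  cases n with
  | zero => simp [hermitePoly]
  | succ n => simpa using derivative_hermitePoly_succ n

/-- The normalizing factor of the `n`-th Hermite function. -/
def hermiteNorm (n : ℕ) : ℝ := 1 / Real.sqrt (2 ^ n * (n ! : ℝ) * Real.sqrt Real.pi)

theorem hermiteNorm_eq_mul_succ (n : ℕ) :
    hermiteNorm n = Real.sqrt (2 * (n + 1)) * hermiteNorm (n + 1) := by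
  have h : (2 : ℝ) ^ (n + 1) * ((n + 1)! : ℝ) * Real.sqrt Real.pi =
      (2 * (n + 1)) * (2 ^ n * (n ! : ℝ) * Real.sqrt Real.pi) := by
    rw [Nat.factorial_succ]; push_cast; ring
  have h1 : Real.sqrt (2 * ((n : ℝ) + 1)) ≠ 0 := by positivity
  rw [hermiteNorm, hermiteNorm, h, Real.sqrt_mul (x := 2 * ((n : ℝ) + 1)) (by positivity),
    mul_one_div, div_mul_cancel_left₀ h1, one_div]

theorem hermiteFun_apply' (k : ℕ) (q : ℝ) :
    hermiteFun k q =
      ((hermiteNorm k * Real.exp (-(q ^ 2 / 2)) * (hermitePoly k).eval q : ℝ) : ℂ) :=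
  hermiteFun_apply k q

theorem deriv_hermiteFun (k : ℕ) (q : ℝ) :
    deriv (hermiteFun k) q = ((hermiteNorm k * Real.exp (-(q ^ 2 / 2)) *
      ((Polynomial.derivative (hermitePoly k)).eval q - q * (hermitePoly k).eval q) : ℝ) : ℂ) := by
  have h1 : HasDerivAt (fun q : ℝ => Real.exp (-(q ^ 2 / 2)))
      (Real.exp (-(q ^ 2 / 2)) * (-q)) q := by
    have h0 : HasDerivAt (fun q : ℝ => -(q ^ 2 / 2)) (-q) q :=
      (((hasDerivAt_pow 2 q).div_const 2).neg).congr_deriv (by push_cast; ring)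
    exact h0.exp
  have h2 := ((h1.const_mul (hermiteNorm k)).mul ((hermitePoly k).hasDerivAt q)).ofReal_comp
  have h3 : (hermiteFun k : ℝ → ℂ) = fun q : ℝ =>
      ((hermiteNorm k * Real.exp (-(q ^ 2 / 2)) * (hermitePoly k).eval q : ℝ) : ℂ) :=
    funext (hermiteFun_apply' k)
  rw [h3]
  refine h2.deriv.trans ?_
  push_cast
  ring

theorem raiseQ_hermiteFun (k : ℕ) :
    raiseQ (hermiteFun k) = (Real.sqrt (2 * (k + 1)) : ℂ) • hermiteFun (k + 1) := by
  ext q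
  change mulQ (hermiteFun k) q - derivQ (hermiteFun k) q = _ * hermiteFun (k + 1) q
  rw [mulQ_apply, derivQ_apply, deriv_hermiteFun, hermiteFun_apply', hermiteFun_apply',
    hermiteNorm_eq_mul_succ k]
  simp only [hermitePoly, Polynomial.eval_sub, Polynomial.eval_mul, Polynomial.eval_X,
    Polynomial.eval_ofNat]
  push_cast
  ring

/-- For `k = 0` the truncated index `k - 1` is harmless, as the factor `√(2 k)` vanishes; the same
applies to `hermiteCoeff_raiseQ`. -/
theorem lowerQ_hermiteFun (k : ℕ) :
    lowerQ (hermiteFun k) = (Real.sqrt (2 * k) : ℂ) • hermiteFun (k - 1) := by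
  ext q
  change mulQ (hermiteFun k) q + derivQ (hermiteFun k) q = _ * hermiteFun (k - 1) q
  rw [mulQ_apply, derivQ_apply, deriv_hermiteFun, hermiteFun_apply', hermiteFun_apply',
    derivative_hermitePoly]
  cases k with
  | zero =>
    simp only [hermitePoly]
    push_cast
    simp
    ring
  | succ k =>
    have hs : (Real.sqrt (2 * (k + 1)) : ℂ) * Real.sqrt (2 * (k + 1)) = 2 * (k + 1) := by
      rw [← Complex.ofReal_mul, Real.mul_self_sqrt (by positivity)]
      push_cast; ring
    simp only [add_tsub_cancel_right, hermiteNorm_eq_mul_succ k, Polynomial.eval_smul, smul_eq_mul]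
    push_cast
    linear_combination (-(hermiteNorm (k + 1) * Complex.exp (-(q ^ 2 / 2)) *
      (hermitePoly k).eval q : ℂ)) * hs

/-! ### Hermite coefficients -/

/-- The bilinear pairing `∫ f g` as a continuous functional of `g`. -/
def pairCLM (f : 𝓢(ℝ, ℂ)) : 𝓢(ℝ, ℂ) →L[ℂ] ℂ :=
  SchwartzMap.integralCLM ℂ volume ∘L SchwartzMap.pairing (ContinuousLinearMap.mul ℂ ℂ) f

theorem pairCLM_apply (f g : 𝓢(ℝ, ℂ)) : pairCLM f g = ∫ q, f q * g q := rfl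

theorem integrable_mul (f g : 𝓢(ℝ, ℂ)) : Integrable (fun q => f q * g q) :=
  (SchwartzMap.pairing (ContinuousLinearMap.mul ℂ ℂ) f g).integrable

theorem pairCLM_mulQ (f g : 𝓢(ℝ, ℂ)) : pairCLM f (mulQ g) = pairCLM (mulQ f) g := by
  simp only [pairCLM_apply, mulQ_apply]
  congr 1; ext q; ring

theorem pairCLM_derivQ (f g : 𝓢(ℝ, ℂ)) : pairCLM f (derivQ g) = -pairCLM (derivQ f) g :=
  SchwartzMap.integral_mul_deriv_eq_neg_deriv_mul f g

theorem pairCLM_add_left (f f' g : 𝓢(ℝ, ℂ)) :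
    pairCLM (f + f') g = pairCLM f g + pairCLM f' g := by
  simp only [pairCLM_apply]
  rw [← integral_add (integrable_mul f g) (integrable_mul f' g)]
  congr 1; ext q; simp [add_mul]

theorem pairCLM_smul_left (a : ℂ) (f g : 𝓢(ℝ, ℂ)) : pairCLM (a • f) g = a * pairCLM f g := by
  simp only [pairCLM_apply]
  rw [← integral_const_mul]
  congr 1; ext q; simp [mul_assoc]

theorem pairCLM_lowerQ (f g : 𝓢(ℝ, ℂ)) : pairCLM f (lowerQ g) = pairCLM (raiseQ f) g := by
  have h : raiseQ f = mulQ f + (-1 : ℂ) • derivQ f := by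
    simp [raiseQ, sub_eq_add_neg]
  rw [h, pairCLM_add_left, pairCLM_smul_left, lowerQ, LinearMap.add_apply, map_add, pairCLM_mulQ,
    pairCLM_derivQ]
  ring

theorem pairCLM_raiseQ (f g : 𝓢(ℝ, ℂ)) : pairCLM f (raiseQ g) = pairCLM (lowerQ f) g := by
  rw [lowerQ, LinearMap.add_apply, pairCLM_add_left, raiseQ, LinearMap.sub_apply, map_sub,
    pairCLM_mulQ, pairCLM_derivQ]
  ring

/-- The `k`-th Hermite coefficient `∫ ψₖ f`; no conjugation is needed as `ψₖ` is real valued. -/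
def hermiteCoeff (k : ℕ) : 𝓢(ℝ, ℂ) →L[ℂ] ℂ := pairCLM (hermiteFun k)

theorem hermiteCoeff_lowerQ (k : ℕ) (f : 𝓢(ℝ, ℂ)) :
    hermiteCoeff k (lowerQ f) = Real.sqrt (2 * (k + 1)) * hermiteCoeff (k + 1) f := by
  rw [hermiteCoeff, pairCLM_lowerQ, raiseQ_hermiteFun, pairCLM_smul_left, hermiteCoeff]

theorem hermiteCoeff_raiseQ (k : ℕ) (f : 𝓢(ℝ, ℂ)) :
    hermiteCoeff k (raiseQ f) = Real.sqrt (2 * k) * hermiteCoeff (k - 1) f := by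
  rw [hermiteCoeff, pairCLM_raiseQ, lowerQ_hermiteFun, pairCLM_smul_left, hermiteCoeff]

theorem hermiteCoeff_zero_hermiteFun_zero : hermiteCoeff 0 (hermiteFun 0) = 1 := by
  have h1 : ∀ q : ℝ, hermiteFun 0 q * hermiteFun 0 q =
      (((Real.sqrt Real.pi)⁻¹ * Real.exp (-1 * q ^ 2) : ℝ) : ℂ) := by
    intro q
    have h2 : Real.exp (-1 * q ^ 2) = Real.exp (-(q ^ 2 / 2)) * Real.exp (-(q ^ 2 / 2)) := by
      rw [← Real.exp_add]; congr 1; ring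
    have h3 : hermiteNorm 0 * hermiteNorm 0 = (Real.sqrt Real.pi)⁻¹ := by
      simp only [hermiteNorm, pow_zero, Nat.factorial_zero, Nat.cast_one, one_mul]
      rw [div_mul_div_comm, Real.mul_self_sqrt (by positivity)]
      simp
    rw [hermiteFun_apply', ← Complex.ofReal_mul, h2, ← h3]
    congr 1
    simp only [hermitePoly, Polynomial.eval_one]
    ring
  rw [hermiteCoeff, pairCLM_apply]
  simp_rw [h1]
  rw [integral_complex_ofReal, integral_const_mul, integral_gaussian]
  have : Real.sqrt Real.pi ≠ 0 := by positivity
  simp [this]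

/-- The Hermite functions are orthonormal. -/
theorem hermiteCoeff_hermiteFun (j k : ℕ) :
    hermiteCoeff j (hermiteFun k) = if j = k then 1 else 0 := by
  have hne : ∀ n : ℕ, ((Real.sqrt (2 * (n + 1)) : ℝ) : ℂ) ≠ 0 := fun n =>
    Complex.ofReal_ne_zero.2 (by positivity)
  induction j generalizing k with
  | zero =>
    cases k with
    | zero => simpa using hermiteCoeff_zero_hermiteFun_zero
    | succ k =>
      have h := hermiteCoeff_raiseQ 0 (hermiteFun k)
      rw [raiseQ_hermiteFun, map_smul] at h
      simpa using (mul_eq_zero.1 (by simpa using! h)).resolve_left (hne k)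
  | succ j ih =>
    have h := hermiteCoeff_lowerQ j (hermiteFun k)
    rw [lowerQ_hermiteFun, map_smul, ih] at h
    refine mul_left_cancel₀ (hne j) (h.symm.trans ?_)
    cases k with
    | zero => simp
    | succ k =>
      by_cases hjk : j = k
      · subst hjk; simp
      · simp [hjk]

theorem hermiteFun_mul_self (k : ℕ) (q : ℝ) :
    hermiteFun k q * hermiteFun k q = ((‖hermiteFun k q‖ ^ 2 : ℝ) : ℂ) := by
  rw [hermiteFun_apply', ← Complex.ofReal_mul, Complex.norm_real, Real.norm_eq_abs, sq_abs,
    ← pow_two]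

theorem integrable_norm_sq_hermiteFun (k : ℕ) : Integrable (fun q => ‖hermiteFun k q‖ ^ 2) := by
  have h := (integrable_mul (hermiteFun k) (hermiteFun k)).re
  simpa [hermiteFun_mul_self, ← Complex.ofReal_pow] using! h

theorem integral_norm_sq_hermiteFun (k : ℕ) : ∫ q, ‖hermiteFun k q‖ ^ 2 = 1 := by
  have h := hermiteCoeff_hermiteFun k k
  rw [hermiteCoeff, pairCLM_apply, if_pos rfl] at h
  simp_rw [hermiteFun_mul_self] at h
  rw [integral_complex_ofReal] at h
  exact_mod_cast h

theorem norm_derivQ_hermiteFun_sq_le (k : ℕ) (q : ℝ) :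
    ‖derivQ (hermiteFun k) q‖ ^ 2 ≤
      k * ‖hermiteFun (k - 1) q‖ ^ 2 + (k + 1) * ‖hermiteFun (k + 1) q‖ ^ 2 := by
  have h : derivQ (hermiteFun k) q = (1 / 2 : ℂ) * (Real.sqrt (2 * k) * hermiteFun (k - 1) q -
      Real.sqrt (2 * (k + 1)) * hermiteFun (k + 1) q) := by
    rw [derivQ_eq, lowerQ_hermiteFun, raiseQ_hermiteFun]
    rfl
  have h1 : ‖derivQ (hermiteFun k) q‖ ≤ (1 / 2) * (Real.sqrt (2 * k) * ‖hermiteFun (k - 1) q‖ +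
      Real.sqrt (2 * (k + 1)) * ‖hermiteFun (k + 1) q‖) := by
    rw [h, norm_mul]
    refine mul_le_mul (by simp) ((norm_sub_le _ _).trans (le_of_eq ?_)) (norm_nonneg _)
      (by norm_num)
    rw [norm_mul, norm_mul, Complex.norm_real, Complex.norm_real,
      Real.norm_of_nonneg (Real.sqrt_nonneg _), Real.norm_of_nonneg (Real.sqrt_nonneg _)]
  have h2 := pow_le_pow_left₀ (norm_nonneg _) h1 2
  have h3 : Real.sqrt (2 * k) ^ 2 = 2 * k := Real.sq_sqrt (by positivity)
  have h4 : Real.sqrt (2 * (k + 1)) ^ 2 = 2 * ((k : ℝ) + 1) := Real.sq_sqrt (by positivity)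
  have h5 := sq_nonneg (Real.sqrt (2 * k) * ‖hermiteFun (k - 1) q‖ -
      Real.sqrt (2 * (k + 1)) * ‖hermiteFun (k + 1) q‖)
  have h6 : (Real.sqrt (2 * k) * ‖hermiteFun (k - 1) q‖) ^ 2 =
      2 * k * ‖hermiteFun (k - 1) q‖ ^ 2 := by rw [mul_pow, h3]
  have h7 : (Real.sqrt (2 * (k + 1)) * ‖hermiteFun (k + 1) q‖) ^ 2 =
      2 * (k + 1) * ‖hermiteFun (k + 1) q‖ ^ 2 := by rw [mul_pow, h4]
  nlinarith

/-- The supremum of a Hermite function grows at most linearly in its index: by the one dimensional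
Sobolev inequality, `‖ψₖ‖²_∞ ≤ ‖ψₖ‖²₂ + ‖ψₖ'‖²₂ ≤ 2 k + 2`. -/
theorem norm_hermiteFun_le (k : ℕ) (x : ℝ) : ‖hermiteFun k x‖ ≤ 2 * (k + 1) := by
  set f := hermiteFun k with hf
  have hd : ∀ q ∈ Set.Iic x, HasDerivAt (fun q => f q * f q)
      (deriv f q * f q + f q * deriv f q) q :=
    fun q _ => (f.hasDerivAt q).mul (f.hasDerivAt q)
  have hint : Integrable (fun q => deriv f q * f q + f q * deriv f q) :=
    (integrable_mul (derivQ f) f).add (integrable_mul f (derivQ f))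
  have hlim : Tendsto (fun q => f q * f q) atBot (𝓝 0) := by
    have := (f.tendsto_cocompact).mono_left (atBot_le_cocompact (α := ℝ))
    simpa using this.mul this
  have h1 := integral_Iic_of_hasDerivAt_of_tendsto' hd hint.integrableOn hlim
  set g : ℝ → ℝ := fun q => ‖f q‖ ^ 2 + (k * ‖hermiteFun (k - 1) q‖ ^ 2 +
    (k + 1) * ‖hermiteFun (k + 1) q‖ ^ 2) with hg
  have hi0 : Integrable (fun q => ‖f q‖ ^ 2) := integrable_norm_sq_hermiteFun k
  have hi1 : Integrable (fun q => k * ‖hermiteFun (k - 1) q‖ ^ 2) :=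
    (integrable_norm_sq_hermiteFun (k - 1)).const_mul _
  have hi2 : Integrable (fun q => ((k : ℝ) + 1) * ‖hermiteFun (k + 1) q‖ ^ 2) :=
    (integrable_norm_sq_hermiteFun (k + 1)).const_mul _
  have hi3 : Integrable (fun q => k * ‖hermiteFun (k - 1) q‖ ^ 2 +
    ((k : ℝ) + 1) * ‖hermiteFun (k + 1) q‖ ^ 2) := hi1.add hi2
  have hgi : Integrable g := hi0.add hi3
  have hgint : ∫ q, g q = 2 * k + 2 := by
    rw [hg, integral_add hi0 hi3, integral_add hi1 hi2, integral_const_mul,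
      integral_const_mul]
    rw [hf]
    simp only [integral_norm_sq_hermiteFun]
    ring
  have hbound : ∀ q, ‖deriv f q * f q + f q * deriv f q‖ ≤ g q := by
    intro q
    have h2 := norm_derivQ_hermiteFun_sq_le k q
    rw [derivQ_apply, ← hf] at h2
    have h3 : ‖deriv f q * f q + f q * deriv f q‖ = 2 * (‖f q‖ * ‖deriv f q‖) := by
      rw [show deriv f q * f q + f q * deriv f q = 2 * (f q * deriv f q) by ring]
      simp
    rw [h3, hg]
    nlinarith [sq_nonneg (‖f q‖ - ‖deriv f q‖)]
  have h4 : ‖f x * f x‖ ≤ 2 * k + 2 := by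
    rw [← sub_zero (f x * f x), ← h1, ← hgint]
    refine (norm_integral_le_of_norm_le hgi.integrableOn (Eventually.of_forall hbound)).trans ?_
    exact setIntegral_le_integral hgi (Eventually.of_forall fun q => by positivity)
  rw [norm_mul] at h4
  have hk : (0 : ℝ) ≤ k := Nat.cast_nonneg k
  nlinarith [norm_nonneg (f x)]

theorem norm_hermiteCoeff_le (k : ℕ) (f : 𝓢(ℝ, ℂ)) :
    ‖hermiteCoeff k f‖ ≤ 2 * (k + 1) * ∫ q, ‖f q‖ := by
  rw [hermiteCoeff, pairCLM_apply, ← integral_const_mul]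
  refine norm_integral_le_of_norm_le (f.integrable.norm.const_mul _)
    (Eventually.of_forall fun q => ?_)
  rw [norm_mul]
  exact mul_le_mul_of_nonneg_right (norm_hermiteFun_le k q) (norm_nonneg _)

theorem hermiteCoeff_lowerQ_raiseQ_iterate (N k : ℕ) (f : 𝓢(ℝ, ℂ)) :
    hermiteCoeff k ((lowerQ * raiseQ : Module.End ℂ 𝓢(ℝ, ℂ)) ^ N • f) =
      (2 * (k + 1)) ^ N * hermiteCoeff k f := by
  induction N with
  | zero => simp
  | succ N ih =>
    have hs : (Real.sqrt (2 * (k + 1)) : ℂ) * Real.sqrt (2 * (k + 1)) = 2 * (k + 1) := by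
      rw [← Complex.ofReal_mul, Real.mul_self_sqrt (by positivity)]
      push_cast; ring
    rw [pow_succ', mul_smul]
    change hermiteCoeff k (lowerQ (raiseQ _)) = _
    rw [hermiteCoeff_lowerQ, hermiteCoeff_raiseQ, add_tsub_cancel_right, ih]
    push_cast
    linear_combination ((2 * (k + 1)) ^ N * hermiteCoeff k f) * hs

/-- The Hermite coefficients of a Schwartz function decay rapidly: those of
`((q + ∂_q) (q - ∂_q))ⁿ f` are `(2 (k + 1))ⁿ` times those of `f`, and grow at most linearly. -/
theorem summable_hermiteCoeff (N : ℕ) (f : 𝓢(ℝ, ℂ)) :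
    Summable fun k : ℕ => ((k : ℝ) + 1) ^ N * ‖hermiteCoeff k f‖ := by
  -- three additional powers: one for the linear growth, two for summability
  set g := (lowerQ * raiseQ : Module.End ℂ 𝓢(ℝ, ℂ)) ^ (N + 3) • f
  have hs : Summable fun k : ℕ => 2 * (∫ q, ‖g q‖) * (1 / ((k : ℝ) + 1) ^ 2) := by
    refine Summable.mul_left _ ?_
    have := (summable_nat_add_iff 1).2 (Real.summable_one_div_nat_pow.2 (one_lt_two))
    simpa using this
  refine hs.of_nonneg_of_le (fun k => by positivity) fun k => ?_
  have h1 := norm_hermiteCoeff_le k g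
  rw [hermiteCoeff_lowerQ_raiseQ_iterate, norm_mul, norm_pow] at h1
  have h2 : ‖(2 * ((k : ℂ) + 1))‖ = 2 * ((k : ℝ) + 1) := by
    have : (2 * ((k : ℂ) + 1)) = ((2 * ((k : ℝ) + 1) : ℝ) : ℂ) := by push_cast; ring
    rw [this, Complex.norm_real, Real.norm_of_nonneg (by positivity)]
  rw [h2, mul_pow] at h1
  have h3 : (1 : ℝ) ≤ 2 ^ (N + 3) := one_le_pow₀ (by norm_num)
  have hk : (0 : ℝ) < (k : ℝ) + 1 := by positivity
  have h4 : ((k : ℝ) + 1) ^ (N + 3) * ‖hermiteCoeff k f‖ ≤ 2 * (k + 1) * ∫ q, ‖g q‖ := by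
    refine le_trans ?_ h1
    rw [mul_assoc]
    exact le_mul_of_one_le_left (by positivity) h3
  rw [mul_one_div, le_div_iff₀ (by positivity)]
  refine le_of_mul_le_mul_right ?_ hk
  calc _ = ((k : ℝ) + 1) ^ (N + 3) * ‖hermiteCoeff k f‖ := by ring
    _ ≤ _ := h4
    _ = _ := by ring

/-! ### Completeness of the Hermite functions -/

/-- By this closure property the span contains all the functions `q ^ n * exp (-q² / 2)`. -/
theorem mulQ_mem_span_hermiteFun {f : 𝓢(ℝ, ℂ)} (hf : f ∈ Submodule.span ℂ (Set.range hermiteFun)) :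
    mulQ f ∈ Submodule.span ℂ (Set.range hermiteFun) := by
  have hmem : ∀ k, hermiteFun k ∈ Submodule.span ℂ (Set.range hermiteFun) :=
    fun k => Submodule.subset_span ⟨k, rfl⟩
  induction hf using Submodule.span_induction with
  | mem f hf =>
    obtain ⟨k, rfl⟩ := hf
    rw [mulQ_eq, lowerQ_hermiteFun, raiseQ_hermiteFun]
    exact Submodule.smul_mem _ _ (Submodule.add_mem _ (Submodule.smul_mem _ _ (hmem _))
      (Submodule.smul_mem _ _ (hmem _)))
  | zero => simp
  | add f g _ _ hf hg => simpa using Submodule.add_mem _ hf hg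
  | smul a f _ hf => simpa using Submodule.smul_mem _ a hf

theorem gaussian_mem_span_hermiteFun : gaussian ∈ Submodule.span ℂ (Set.range hermiteFun) := by
  have h0 : (hermiteNorm 0 : ℂ) ≠ 0 := by
    refine Complex.ofReal_ne_zero.2 ?_
    simp only [hermiteNorm]
    positivity
  have h : gaussian = (hermiteNorm 0 : ℂ)⁻¹ • hermiteFun 0 := by
    ext q
    change _ = (hermiteNorm 0 : ℂ)⁻¹ * hermiteFun 0 q
    rw [hermiteFun_apply', gaussian_apply, eq_inv_mul_iff_mul_eq₀ h0]
    simp [hermitePoly]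
  rw [h]
  exact Submodule.smul_mem _ _ (Submodule.subset_span ⟨0, rfl⟩)

theorem mulQ_pow_apply (n : ℕ) (f : 𝓢(ℝ, ℂ)) (q : ℝ) :
    ((mulQ ^ n : Module.End ℂ 𝓢(ℝ, ℂ)) f) q = (q : ℂ) ^ n * f q := by
  induction n with
  | zero => simp
  | succ n ih =>
    rw [pow_succ', Module.End.mul_apply, mulQ_apply, ih]
    ring

theorem integrable_bounded_mul {u : ℝ → ℂ} (hu : Continuous u) {M : ℝ} (hM : ∀ q, ‖u q‖ ≤ M)
    (f : 𝓢(ℝ, ℂ)) : Integrable (fun q => u q * f q) :=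
  f.integrable.bdd_mul hu.aestronglyMeasurable (Eventually.of_forall hM)

theorem integral_mul_eq_zero_of_mem_span {u : ℝ → ℂ} (hu : Continuous u) {M : ℝ}
    (hM : ∀ q, ‖u q‖ ≤ M) (h : ∀ k, ∫ q, u q * hermiteFun k q = 0) {f : 𝓢(ℝ, ℂ)}
    (hf : f ∈ Submodule.span ℂ (Set.range hermiteFun)) : ∫ q, u q * f q = 0 := by
  induction hf using Submodule.span_induction with
  | mem f hf =>
    obtain ⟨k, rfl⟩ := hf
    exact h k
  | zero => simp
  | add f g _ _ hf hg =>
    have := integral_add (integrable_bounded_mul hu hM f) (integrable_bounded_mul hu hM g)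
    simpa [mul_add, hf, hg] using this
  | smul a f _ hf =>
    have := integral_const_mul (μ := volume) a (fun q => u q * f q)
    simpa [hf, mul_left_comm] using this

theorem integrable_exp_mul_gaussian (a : ℝ) :
    Integrable (fun q : ℝ => Real.exp (a * |q|) * Real.exp (-(q ^ 2 / 2))) := by
  -- complete the square: `a |q| ≤ a² + q² / 4`
  refine ((integrable_exp_neg_mul_sq (b := 1 / 4) (by norm_num)).const_mul
    (Real.exp (a ^ 2))).mono' (by fun_prop) (Eventually.of_forall fun q => ?_)
  rw [Real.norm_of_nonneg (by positivity), ← Real.exp_add, ← Real.exp_add]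
  refine Real.exp_le_exp.2 ?_
  nlinarith [sq_nonneg (a - |q| / 2), sq_abs q]

/-- A bounded continuous function that is orthogonal to all the Hermite functions vanishes: all
the moments of `u e^{-q²/2}` are zero, hence so is its Fourier transform, which is the sum of
the exponential series of these moments. -/
theorem eq_zero_of_integral_mul_hermiteFun {u : ℝ → ℂ} (hu : Continuous u) {M : ℝ}
    (hM : ∀ q, ‖u q‖ ≤ M) (h : ∀ k, ∫ q, u q * hermiteFun k q = 0) : u = 0 := by
  have hmom : ∀ n : ℕ, ∫ q : ℝ, u q * ((q : ℂ) ^ n * gaussian q) = 0 := by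
    intro n
    have hmem : (mulQ ^ n : Module.End ℂ 𝓢(ℝ, ℂ)) gaussian ∈
        Submodule.span ℂ (Set.range hermiteFun) := by
      induction n with
      | zero => simpa using gaussian_mem_span_hermiteFun
      | succ n ih =>
        rw [pow_succ', Module.End.mul_apply]
        exact mulQ_mem_span_hermiteFun ih
    have := integral_mul_eq_zero_of_mem_span hu hM h hmem
    simpa only [mulQ_pow_apply] using this
  set v : ℝ → ℂ := fun q => u q * gaussian q with hv
  have hvi : Integrable v := integrable_bounded_mul hu hM gaussian
  have hvc : Continuous v := hu.mul gaussian.continuous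
  have hM0 : 0 ≤ M := (norm_nonneg _).trans (hM 0)
  have hvb : ∀ q, ‖v q‖ ≤ M * Real.exp (-(q ^ 2 / 2)) := by
    intro q
    rw [hv, norm_mul, gaussian_apply, Complex.norm_real, Real.norm_of_nonneg (Real.exp_pos _).le]
    exact mul_le_mul_of_nonneg_right (hM q) (Real.exp_pos _).le
  have hF : FourierTransform.fourier v = 0 := by
    ext w
    rw [Real.fourier_real_eq_integral_exp_smul]
    set c : ℂ := -2 * Real.pi * w * Complex.I with hc
    have hexp : ∀ q : ℝ, HasSum (fun n : ℕ => ((c ^ n / (n ! : ℂ)) * ((q : ℂ) ^ n * v q)))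
        (Complex.exp (↑(-2 * Real.pi * q * w) * Complex.I) • v q) := by
      intro q
      have h1 := (NormedSpace.expSeries_div_hasSum_exp (𝔸 := ℂ) (c * q)).mul_right (v q)
      rw [← Complex.exp_eq_exp_ℂ] at h1
      have h2 : (↑(-2 * Real.pi * q * w) * Complex.I : ℂ) = c * q := by
        rw [hc]; push_cast; ring
      rw [h2, smul_eq_mul]
      refine h1.congr_fun ?_
      intro n
      rw [mul_pow]; ring
    have hsum : ∀ q : ℝ, HasSum (fun n : ℕ => (‖c‖ * |q|) ^ n / (n ! : ℝ) *
        (M * Real.exp (-(q ^ 2 / 2)))) (Real.exp (‖c‖ * |q|) * (M * Real.exp (-(q ^ 2 / 2)))) := by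
      intro q
      have h1 := (NormedSpace.expSeries_div_hasSum_exp (𝔸 := ℝ) (‖c‖ * |q|)).mul_right
        (M * Real.exp (-(q ^ 2 / 2)))
      rwa [← Real.exp_eq_exp_ℝ] at h1
    have hs := hasSum_integral_of_dominated_convergence (μ := volume)
      (F := fun (n : ℕ) (q : ℝ) => (c ^ n / (n ! : ℂ)) * ((q : ℂ) ^ n * v q))
      (f := fun q : ℝ => Complex.exp (↑(-2 * Real.pi * q * w) * Complex.I) • v q)
      (fun n q => (‖c‖ * |q|) ^ n / (n ! : ℝ) * (M * Real.exp (-(q ^ 2 / 2))))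
      (fun n => by
        have : Continuous fun q : ℝ => (c ^ n / (n ! : ℂ)) * ((q : ℂ) ^ n * v q) := by fun_prop
        exact this.aestronglyMeasurable)
      (fun n => Eventually.of_forall fun q => by
        rw [norm_mul, norm_mul, norm_div, norm_pow, norm_pow, Complex.norm_real, Real.norm_eq_abs,
          Complex.norm_natCast, mul_pow, ← mul_assoc]
        refine (mul_le_mul_of_nonneg_left (hvb q) (by positivity)).trans (le_of_eq ?_)
        ring)
      (Eventually.of_forall fun q => (hsum q).summable)
      (by
        simp_rw [fun q => (hsum q).tsum_eq]
        refine ((integrable_exp_mul_gaussian ‖c‖).const_mul M).congr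
          (Eventually.of_forall fun q => ?_)
        simp only
        ring)
      (Eventually.of_forall hexp)
    have hz : ∀ n : ℕ, ∫ q : ℝ, (c ^ n / (n ! : ℂ)) * ((q : ℂ) ^ n * v q) = 0 := by
      intro n
      rw [integral_const_mul]
      have : ∀ q : ℝ, (q : ℂ) ^ n * v q = u q * ((q : ℂ) ^ n * gaussian q) := by
        intro q; rw [hv]; ring
      simp_rw [this, hmom n, mul_zero]
    simp_rw [hz] at hs
    exact hs.unique hasSum_zero
  have hinv := hvc.fourierInv_fourier_eq hvi (by rw [hF]; exact integrable_zero _ _ _)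
  have hv0 : v = 0 := by
    rw [← hinv, hF]
    ext x
    simp [Real.fourierInv_eq]
  ext q
  have h1 := congrFun hv0 q
  have h2 : gaussian q ≠ 0 := by
    rw [gaussian_apply]
    exact Complex.ofReal_ne_zero.2 (Real.exp_pos _).ne'
  exact (mul_eq_zero.1 h1).resolve_right h2

/-! ### Hermite expansions in the Schwartz space -/

theorem norm_hermiteCoeff_mul_hermiteFun_le (f : 𝓢(ℝ, ℂ)) (k : ℕ) (x : ℝ) :
    ‖hermiteCoeff k f * hermiteFun k x‖ ≤ 2 * (((k : ℝ) + 1) ^ 1 * ‖hermiteCoeff k f‖) := by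
  rw [norm_mul]
  refine (mul_le_mul_of_nonneg_left (norm_hermiteFun_le k x) (norm_nonneg _)).trans (le_of_eq ?_)
  ring

theorem hasSum_hermite_apply (f : 𝓢(ℝ, ℂ)) (x : ℝ) :
    HasSum (fun k => hermiteCoeff k f * hermiteFun k x) (f x) := by
  have hb := (summable_hermiteCoeff 1 f).mul_left 2
  have hsum : ∀ x, Summable (fun k => hermiteCoeff k f * hermiteFun k x) := fun x =>
    Summable.of_norm_bounded hb fun k => norm_hermiteCoeff_mul_hermiteFun_le f k x
  set g : ℝ → ℂ := fun x => ∑' k, hermiteCoeff k f * hermiteFun k x with hg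
  have hgc : Continuous g := continuous_tsum
    (fun k => continuous_const.mul (hermiteFun k).continuous) hb
    fun k x => norm_hermiteCoeff_mul_hermiteFun_le f k x
  have hgb : ∀ x, ‖g x‖ ≤ ∑' k : ℕ, 2 * (((k : ℝ) + 1) ^ 1 * ‖hermiteCoeff k f‖) := fun x =>
    tsum_of_norm_bounded hb.hasSum fun k => norm_hermiteCoeff_mul_hermiteFun_le f k x
  -- `g` has the same Hermite coefficients as `f`, so `f - g` is orthogonal to all `ψⱼ`
  have horth : ∀ j, ∫ q, g q * hermiteFun j q = hermiteCoeff j f := by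
    intro j
    have h1 := hasSum_integral_of_summable_integral_norm (μ := volume)
      (F := fun k q => hermiteCoeff k f * hermiteFun k q * hermiteFun j q)
      (fun k => by
        simpa only [mul_assoc] using! (integrable_mul (hermiteFun k) (hermiteFun j)).const_mul
          (hermiteCoeff k f))
      (by
        refine Summable.of_nonneg_of_le (fun k => integral_nonneg fun q => norm_nonneg _)
          (fun k => ?_) (hb.mul_right (∫ q, ‖hermiteFun j q‖))
        rw [← integral_const_mul]
        refine integral_mono_of_nonneg (Eventually.of_forall fun q => norm_nonneg _)
          ((hermiteFun j).integrable.norm.const_mul _) (Eventually.of_forall fun q => ?_)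
        simp only
        rw [norm_mul]
        exact mul_le_mul_of_nonneg_right (norm_hermiteCoeff_mul_hermiteFun_le f k q)
          (norm_nonneg _))
    have h2 : ∀ k, ∫ q, hermiteCoeff k f * hermiteFun k q * hermiteFun j q =
        if k = j then hermiteCoeff j f else 0 := by
      intro k
      have h3 := hermiteCoeff_hermiteFun k j
      rw [hermiteCoeff, pairCLM_apply] at h3
      simp_rw [mul_assoc]
      rw [integral_const_mul, h3]
      split_ifs with hkj
      · rw [hkj, mul_one]
      · rw [mul_zero]
    simp_rw [h2, tsum_mul_right] at h1
    exact h1.unique (hasSum_ite_eq j _)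
  have hfb : ∀ x, ‖f x‖ ≤ SchwartzMap.seminorm ℝ 0 0 f := f.norm_le_seminorm ℝ
  have hzero := eq_zero_of_integral_mul_hermiteFun (u := fun x => f x - g x)
    (f.continuous.sub hgc) (fun x => (norm_sub_le _ _).trans (add_le_add (hfb x) (hgb x)))
    (fun k => by
      simp_rw [sub_mul]
      rw [integral_sub (integrable_mul f (hermiteFun k)) (integrable_bounded_mul hgc hgb _), horth,
        hermiteCoeff, pairCLM_apply, sub_eq_zero]
      simp_rw [mul_comm])
  have h4 := sub_eq_zero.1 (congrFun hzero x)
  rw [h4]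
  exact (hsum x).hasSum

/-- The weighted `ℓ¹` norm `∑ (k+1)ᴺ |cₖ|` of the Hermite coefficients. -/
def coeffNorm (N : ℕ) (f : 𝓢(ℝ, ℂ)) : ℝ := ∑' k : ℕ, ((k : ℝ) + 1) ^ N * ‖hermiteCoeff k f‖

theorem coeffNorm_nonneg (N : ℕ) (f : 𝓢(ℝ, ℂ)) : 0 ≤ coeffNorm N f :=
  tsum_nonneg fun k => by positivity

theorem norm_apply_le_coeffNorm (f : 𝓢(ℝ, ℂ)) (x : ℝ) : ‖f x‖ ≤ 2 * coeffNorm 1 f := by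
  rw [← (hasSum_hermite_apply f x).tsum_eq, coeffNorm, ← tsum_mul_left]
  exact tsum_of_norm_bounded ((summable_hermiteCoeff 1 f).mul_left 2).hasSum
    fun k => norm_hermiteCoeff_mul_hermiteFun_le f k x

theorem sqrt_two_mul_le {t : ℝ} (ht : 1 ≤ t) : Real.sqrt (2 * t) ≤ 2 * t :=
  Real.sqrt_le_self_iff.2 (Or.inr (by linarith))

theorem coeffNorm_lowerQ_le (N : ℕ) (f : 𝓢(ℝ, ℂ)) :
    coeffNorm N (lowerQ f) ≤ 2 * coeffNorm (N + 1) f := by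
  have hs := (summable_hermiteCoeff (N + 1) f).mul_left 2
  have h1 := hs.sum_add_tsum_nat_add 1
  rw [tsum_mul_left (a := (2 : ℝ)) (f := fun k : ℕ => ((k : ℝ) + 1) ^ (N + 1) * ‖hermiteCoeff k f‖)]
    at h1
  refine le_trans ?_ (h1.le.trans' (le_add_of_nonneg_left
    (Finset.sum_nonneg fun k _ => by positivity)))
  refine (summable_hermiteCoeff N _).tsum_le_tsum (fun k => ?_) ((summable_nat_add_iff 1).2 hs)
  rw [hermiteCoeff_lowerQ, norm_mul, Complex.norm_real, Real.norm_of_nonneg (Real.sqrt_nonneg _)]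
  have h2 : (1 : ℝ) ≤ (k : ℝ) + 1 := by linarith [(Nat.cast_nonneg k : (0 : ℝ) ≤ k)]
  have h3 : ((k : ℝ) + 1) ^ N * Real.sqrt (2 * (k + 1)) ≤
      ((k + 1 : ℕ) + 1 : ℝ) ^ N * (2 * ((k + 1 : ℕ) + 1)) := by
    push_cast
    refine mul_le_mul (pow_le_pow_left₀ (by positivity) (by linarith) N)
      ((sqrt_two_mul_le h2).trans (by linarith)) (Real.sqrt_nonneg _) (by positivity)
  calc _ = ((k : ℝ) + 1) ^ N * Real.sqrt (2 * (k + 1)) * ‖hermiteCoeff (k + 1) f‖ := by ring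
    _ ≤ ((k + 1 : ℕ) + 1 : ℝ) ^ N * (2 * ((k + 1 : ℕ) + 1)) * ‖hermiteCoeff (k + 1) f‖ :=
      mul_le_mul_of_nonneg_right h3 (norm_nonneg _)
    _ = _ := by ring

/-- Here the index shift goes up, and the weight obeys `k + 2 ≤ 2 (k + 1)`. -/
theorem coeffNorm_raiseQ_le (N : ℕ) (f : 𝓢(ℝ, ℂ)) :
    coeffNorm N (raiseQ f) ≤ 2 ^ (N + 1) * coeffNorm (N + 1) f := by
  have hs := (summable_hermiteCoeff (N + 1) f).mul_left (2 ^ (N + 1))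
  have hs' := summable_hermiteCoeff N (raiseQ f)
  rw [coeffNorm, ← hs'.sum_add_tsum_nat_add 1, coeffNorm, ← tsum_mul_left]
  simp only [Finset.range_one, Finset.sum_singleton, hermiteCoeff_raiseQ, Nat.cast_zero, mul_zero,
    Real.sqrt_zero, Complex.ofReal_zero, zero_mul, norm_zero, zero_add, add_tsub_cancel_right]
  refine Summable.tsum_le_tsum (fun k => ?_) ?_ hs
  · rw [norm_mul, Complex.norm_real, Real.norm_of_nonneg (Real.sqrt_nonneg _)]
    have h2 : (1 : ℝ) ≤ (k : ℝ) + 1 := by linarith [(Nat.cast_nonneg k : (0 : ℝ) ≤ k)]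
    have h3 : ((k + 1 : ℕ) + 1 : ℝ) ^ N * Real.sqrt (2 * (k + 1 : ℕ)) ≤
        (2 * ((k : ℝ) + 1)) ^ N * (2 * (k + 1)) := by
      push_cast
      exact mul_le_mul (pow_le_pow_left₀ (by positivity) (by linarith) N)
        (sqrt_two_mul_le h2) (Real.sqrt_nonneg _) (by positivity)
    calc _ = ((k + 1 : ℕ) + 1 : ℝ) ^ N * Real.sqrt (2 * (k + 1 : ℕ)) * ‖hermiteCoeff k f‖ := by ring
      _ ≤ _ := mul_le_mul_of_nonneg_right h3 (norm_nonneg _)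
      _ = _ := by rw [mul_pow]; ring
  · have := (summable_nat_add_iff 1).2 hs'
    simpa only [hermiteCoeff_raiseQ, add_tsub_cancel_right] using this

theorem coeffNorm_le_half_add (N : ℕ) {f g h : 𝓢(ℝ, ℂ)}
    (hfg : ∀ k, ‖hermiteCoeff k h‖ ≤ (1 / 2) * (‖hermiteCoeff k f‖ + ‖hermiteCoeff k g‖)) :
    coeffNorm N h ≤ (1 / 2) * (coeffNorm N f + coeffNorm N g) := by
  have hf := summable_hermiteCoeff N f
  have hg := summable_hermiteCoeff N g
  rw [coeffNorm, coeffNorm, coeffNorm, ← hf.tsum_add hg, ← tsum_mul_left]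
  refine (summable_hermiteCoeff N h).tsum_le_tsum (fun k => ?_) ((hf.add hg).mul_left _)
  refine (mul_le_mul_of_nonneg_left (hfg k) (by positivity)).trans (le_of_eq ?_)
  ring

theorem coeffNorm_mulQ_le (N : ℕ) (f : 𝓢(ℝ, ℂ)) :
    coeffNorm N (mulQ f) ≤ 2 ^ (N + 1) * coeffNorm (N + 1) f := by
  have h1 := coeffNorm_le_half_add N (h := mulQ f) (f := lowerQ f) (g := raiseQ f) fun k => by
    rw [mulQ_eq, map_smul, norm_smul, map_add]
    exact mul_le_mul (by simp) (norm_add_le _ _) (norm_nonneg _) (by norm_num)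
  have h2 : (2 : ℝ) ≤ 2 ^ (N + 1) := le_self_pow₀ (by norm_num) (by simp)
  have h3 := mul_le_mul_of_nonneg_right h2 (coeffNorm_nonneg (N + 1) f)
  linarith [coeffNorm_lowerQ_le N f, coeffNorm_raiseQ_le N f]

theorem coeffNorm_derivQ_le (N : ℕ) (f : 𝓢(ℝ, ℂ)) :
    coeffNorm N (derivQ f) ≤ 2 ^ (N + 1) * coeffNorm (N + 1) f := by
  have h1 := coeffNorm_le_half_add N (h := derivQ f) (f := lowerQ f) (g := raiseQ f) fun k => by
    rw [derivQ_eq, map_smul, norm_smul, map_sub]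
    exact mul_le_mul (by simp) (norm_sub_le _ _) (norm_nonneg _) (by norm_num)
  have h2 : (2 : ℝ) ≤ 2 ^ (N + 1) := le_self_pow₀ (by norm_num) (by simp)
  have h3 := mul_le_mul_of_nonneg_right h2 (coeffNorm_nonneg (N + 1) f)
  linarith [coeffNorm_lowerQ_le N f, coeffNorm_raiseQ_le N f]

theorem exists_coeffNorm_pow_le {T : Module.End ℂ 𝓢(ℝ, ℂ)}
    (hT : ∀ (N : ℕ) (f : 𝓢(ℝ, ℂ)), coeffNorm N (T f) ≤ 2 ^ (N + 1) * coeffNorm (N + 1) f)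
    (N n : ℕ) : ∃ C : ℝ, 0 ≤ C ∧ ∀ f, coeffNorm N ((T ^ n) f) ≤ C * coeffNorm (N + n) f := by
  induction n generalizing N with
  | zero => exact ⟨1, zero_le_one, fun f => by simp⟩
  | succ n ih =>
    obtain ⟨C, hC, h⟩ := ih (N + 1)
    refine ⟨2 ^ (N + 1) * C, by positivity, fun f => ?_⟩
    rw [pow_succ', Module.End.mul_apply, mul_assoc]
    refine (hT N _).trans (mul_le_mul_of_nonneg_left ?_ (by positivity))
    rw [show N + (n + 1) = N + 1 + n by ring]
    exact h f

theorem derivQ_pow_apply (n : ℕ) (f : 𝓢(ℝ, ℂ)) :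
    ((derivQ ^ n : Module.End ℂ 𝓢(ℝ, ℂ)) f : ℝ → ℂ) = iteratedDeriv n f := by
  induction n with
  | zero => simp
  | succ n ih =>
    rw [pow_succ', Module.End.mul_apply, iteratedDeriv_succ, ← ih]
    rfl

/-- Each Schwartz seminorm is bounded by a weighted `ℓ¹` norm of the Hermite coefficients. -/
theorem exists_seminorm_le_coeffNorm (k n : ℕ) :
    ∃ (C : ℝ) (N : ℕ), ∀ f, SchwartzMap.seminorm ℂ k n f ≤ C * coeffNorm N f := by
  obtain ⟨C, hC, h1⟩ := exists_coeffNorm_pow_le coeffNorm_mulQ_le 1 k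
  obtain ⟨D, hD, h2⟩ := exists_coeffNorm_pow_le coeffNorm_derivQ_le (1 + k) n
  refine ⟨2 * C * D, 1 + k + n, fun f => ?_⟩
  have hN := coeffNorm_nonneg (1 + k + n) f
  refine SchwartzMap.seminorm_le_bound' ℂ k n f (by positivity) fun x => ?_
  have h3 := norm_apply_le_coeffNorm
    ((mulQ ^ k : Module.End ℂ 𝓢(ℝ, ℂ)) ((derivQ ^ n : Module.End ℂ 𝓢(ℝ, ℂ)) f)) x
  rw [mulQ_pow_apply, derivQ_pow_apply, norm_mul, norm_pow, Complex.norm_real,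
    Real.norm_eq_abs] at h3
  refine h3.trans ?_
  rw [mul_assoc, mul_assoc]
  refine mul_le_mul_of_nonneg_left ((h1 _).trans ?_) zero_le_two
  exact mul_le_mul_of_nonneg_left (h2 f) hC

/-- The Hermite expansion of a Schwartz function converges to it in the topology of `𝓢(ℝ)`. -/
theorem hasSum_hermite (f : 𝓢(ℝ, ℂ)) :
    HasSum (fun k => hermiteCoeff k f • hermiteFun k) f := by
  refine ((schwartz_withSeminorms ℂ ℝ ℂ).tendsto_nhds _ _).2 ?_
  rintro ⟨k, n⟩ ε hε
  obtain ⟨C, N, h⟩ := exists_seminorm_le_coeffNorm k n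
  -- the remainder has the coefficients of `-f` outside of the finite set `s`, and none in it
  have hcoef : ∀ (s : Finset ℕ) (j : ℕ),
      hermiteCoeff j (∑ k ∈ s, hermiteCoeff k f • hermiteFun k - f) =
        if j ∈ s then 0 else -hermiteCoeff j f := by
    intro s j
    rw [map_sub, map_sum]
    simp only [map_smul, hermiteCoeff_hermiteFun, smul_eq_mul, mul_ite, mul_one, mul_zero,
      Finset.sum_ite_eq]
    split_ifs <;> simp
  have hnorm : ∀ s : Finset ℕ, coeffNorm N (∑ k ∈ s, hermiteCoeff k f • hermiteFun k - f) =
      coeffNorm N f - ∑ j ∈ s, ((j : ℝ) + 1) ^ N * ‖hermiteCoeff j f‖ := by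
    intro s
    have h1 := (summable_hermiteCoeff N f).sum_add_tsum_compl (s := s)
    rw [coeffNorm, coeffNorm, ← h1, add_sub_cancel_left,
      _root_.tsum_subtype ((s : Set ℕ)ᶜ) fun j : ℕ => ((j : ℝ) + 1) ^ N * ‖hermiteCoeff j f‖]
    refine tsum_congr fun j => ?_
    rw [hcoef]
    by_cases hj : j ∈ s <;> simp [hj]
  have hlim : Tendsto (fun s : Finset ℕ => C *
      coeffNorm N (∑ k ∈ s, hermiteCoeff k f • hermiteFun k - f)) atTop (𝓝 0) := by
    simp_rw [hnorm]
    have h2 : Tendsto (fun s : Finset ℕ => ∑ j ∈ s, ((j : ℝ) + 1) ^ N * ‖hermiteCoeff j f‖) atTop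
        (𝓝 (coeffNorm N f)) := (summable_hermiteCoeff N f).hasSum
    simpa using (h2.const_sub (coeffNorm N f)).const_mul C
  filter_upwards [hlim.eventually (gt_mem_nhds hε)] with s hs
  exact (h _).trans_lt hs

/-! ### Polynomials in the complex coordinates -/

/-- The exponent of the monomial `x ^ p * y ^ (h - p)`. -/
def homExp (h p : ℕ) : Fin 2 →₀ ℕ := Finsupp.single 0 p + Finsupp.single 1 (h - p)

theorem homExp_eq_iff {h p : ℕ} (m : Fin 2 →₀ ℕ) (hm : m.degree = h) :
    homExp h p = m ↔ p = m 0 := by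
  rw [Finsupp.degree_eq_sum, Fin.sum_univ_two] at hm
  constructor
  · rintro rfl
    simp [homExp]
  · intro h0
    ext i
    fin_cases i
    · simp [homExp, h0]
    · simp [homExp]
      omega

theorem degree_homExp {h p : ℕ} (hp : p ≤ h) : (homExp h p).degree = h := by
  rw [Finsupp.degree_eq_sum, Fin.sum_univ_two]
  simp [homExp]
  omega

theorem IsHomogeneous.eq_sum_monomial {P : Pol} {h : ℕ} (hP : P.IsHomogeneous h) :
    P = ∑ p ∈ Finset.range (h + 1),
      P.coeff (homExp h p) • MvPolynomial.monomial (homExp h p) 1 := by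
  ext m
  rw [MvPolynomial.coeff_sum]
  by_cases hm : m.degree = h
  · have hm0 : m 0 ≤ h := by
      rw [Finsupp.degree_eq_sum, Fin.sum_univ_two] at hm
      omega
    have hiff := fun p => homExp_eq_iff (p := p) m hm
    rw [Finset.sum_eq_single (m 0)]
    · rw [MvPolynomial.coeff_smul, MvPolynomial.coeff_monomial, (hiff _).2 rfl]
      simp
    · intro p _ hne
      rw [MvPolynomial.coeff_smul, MvPolynomial.coeff_monomial,
        if_neg (fun e => hne ((hiff p).1 e)), smul_zero]
    · intro hn
      exact absurd (Finset.mem_range.2 (Nat.lt_succ_of_le hm0)) hn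
  · rw [hP.coeff_eq_zero hm]
    refine (Finset.sum_eq_zero fun p hp => ?_).symm
    rw [MvPolynomial.coeff_smul, MvPolynomial.coeff_monomial, if_neg, smul_zero]
    rintro rfl
    exact hm (degree_homExp (Nat.lt_succ_iff.1 (Finset.mem_range.1 hp)))

/-- The change of variables that writes a polynomial in terms of `z` (the new variable `X 0`) and
`z̄` (the new variable `X 1`): `x = (z + z̄) / 2` and `y = -i (z - z̄) / 2`. -/
def toComplexCoords : Pol →ₐ[ℂ] Pol :=
  MvPolynomial.aeval ![MvPolynomial.C (1 / 2) * (MvPolynomial.X 0 + MvPolynomial.X 1),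
    MvPolynomial.C (-Complex.I / 2) * (MvPolynomial.X 0 - MvPolynomial.X 1)]

theorem C_mul_C_eq {a b c : ℂ} (h : a * b = c) :
    (MvPolynomial.C a * MvPolynomial.C b : Pol) = MvPolynomial.C c := by
  rw [← map_mul, h]

theorem C_half_mul_two : (MvPolynomial.C (1 / 2) * 2 : Pol) = 1 := by
  rw [← map_ofNat MvPolynomial.C 2, C_mul_C_eq (c := 1) (by norm_num), map_one]

theorem C_I_mul_C_neg_I_div :
    (MvPolynomial.C Complex.I * MvPolynomial.C (-Complex.I / 2) : Pol) = MvPolynomial.C (1 / 2) :=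
  C_mul_C_eq (by linear_combination (-1 / 2) * Complex.I_mul_I)

theorem toComplexCoords_z : toComplexCoords z = MvPolynomial.X 0 := by
  simp only [toComplexCoords, z, map_add, map_mul, MvPolynomial.aeval_X, MvPolynomial.algHom_C,
    MvPolynomial.algebraMap_eq, Matrix.cons_val_zero, Matrix.cons_val_one]
  linear_combination (MvPolynomial.X 0 - MvPolynomial.X 1) * C_I_mul_C_neg_I_div +
    MvPolynomial.X 0 * C_half_mul_two

theorem toComplexCoords_zbar : toComplexCoords zbar = MvPolynomial.X 1 := by
  simp only [toComplexCoords, zbar, map_sub, map_mul, MvPolynomial.aeval_X,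
    MvPolynomial.algHom_C, MvPolynomial.algebraMap_eq, Matrix.cons_val_zero, Matrix.cons_val_one]
  linear_combination -(MvPolynomial.X 0 - MvPolynomial.X 1) * C_I_mul_C_neg_I_div +
    MvPolynomial.X 1 * C_half_mul_two

theorem aeval_z_zbar_toComplexCoords (P : Pol) :
    MvPolynomial.aeval ![z, zbar] (toComplexCoords P) = P := by
  have h : (MvPolynomial.aeval ![z, zbar]).comp toComplexCoords = AlgHom.id ℂ Pol := by
    refine MvPolynomial.algHom_ext fun i => ?_
    fin_cases i
    · simp only [toComplexCoords, z, zbar, map_add, map_mul, MvPolynomial.aeval_X,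
        MvPolynomial.algHom_C, MvPolynomial.algebraMap_eq, Matrix.cons_val_zero,
        Matrix.cons_val_one, AlgHom.comp_apply, AlgHom.id_apply, Fin.zero_eta]
      linear_combination MvPolynomial.X 0 * C_half_mul_two
    · simp only [toComplexCoords, z, zbar, map_sub, map_mul, MvPolynomial.aeval_X,
        MvPolynomial.algHom_C, MvPolynomial.algebraMap_eq, Matrix.cons_val_zero,
        Matrix.cons_val_one, AlgHom.comp_apply, AlgHom.id_apply, Fin.mk_one]
      linear_combination 2 * MvPolynomial.X 1 * C_I_mul_C_neg_I_div +
        MvPolynomial.X 1 * C_half_mul_two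
  exact DFunLike.congr_fun h P

theorem isHomogeneous_toComplexCoords {P : Pol} {h : ℕ} (hP : P.IsHomogeneous h) :
    (toComplexCoords P).IsHomogeneous h := by
  have h1 := hP.aeval (n := 1) (τ := Fin 2)
    ![MvPolynomial.C (1 / 2) * (MvPolynomial.X 0 + MvPolynomial.X 1),
    MvPolynomial.C (-Complex.I / 2) * (MvPolynomial.X 0 - MvPolynomial.X 1)] (by
      intro i
      fin_cases i
      · simpa using! (MvPolynomial.isHomogeneous_C (Fin 2) (1 / 2 : ℂ)).mul
          ((MvPolynomial.isHomogeneous_X ℂ (0 : Fin 2)).add (MvPolynomial.isHomogeneous_X ℂ 1))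
      · simpa using! (MvPolynomial.isHomogeneous_C (Fin 2) (-Complex.I / 2 : ℂ)).mul
          ((MvPolynomial.isHomogeneous_X ℂ (0 : Fin 2)).sub (MvPolynomial.isHomogeneous_X ℂ 1)))
  simpa [toComplexCoords] using! h1

/-- The coefficient of `z̄ ^ a * z ^ b` in a polynomial. -/
def zCoeff (a b : ℕ) : Pol →ₗ[ℂ] ℂ :=
  MvPolynomial.lcoeff ℂ (Finsupp.single 0 b + Finsupp.single 1 a) ∘ₗ toComplexCoords.toLinearMap

theorem zCoeff_apply (a b : ℕ) (P : Pol) :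
    zCoeff a b P = (toComplexCoords P).coeff (Finsupp.single 0 b + Finsupp.single 1 a) := rfl

theorem zCoeff_zbar_pow_mul_z_pow (a b a' b' : ℕ) :
    zCoeff a b (zbar ^ a' * z ^ b') = if a' = a ∧ b' = b then 1 else 0 := by
  have h : (MvPolynomial.X 1 ^ a' * MvPolynomial.X 0 ^ b' : Pol) =
      MvPolynomial.monomial (Finsupp.single 0 b' + Finsupp.single 1 a') 1 := by
    rw [MvPolynomial.X_pow_eq_monomial, MvPolynomial.X_pow_eq_monomial, MvPolynomial.monomial_mul,
      add_comm, one_mul]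
  rw [zCoeff_apply, map_mul, map_pow, map_pow, toComplexCoords_z, toComplexCoords_zbar, h,
    MvPolynomial.coeff_monomial]
  congr 1
  rw [eq_iff_iff]
  constructor
  · intro e
    exact ⟨by simpa using DFunLike.congr_fun e 1, by simpa using DFunLike.congr_fun e 0⟩
  · rintro ⟨rfl, rfl⟩
    rfl

/-- A homogeneous polynomial is the sum of its terms in `z` and `z̄`. -/
theorem IsHomogeneous.eq_sum_zCoeff {P : Pol} {h : ℕ} (hP : P.IsHomogeneous h) :
    P = ∑ p ∈ Finset.range (h + 1), zCoeff (h - p) p P • (zbar ^ (h - p) * z ^ p) := by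
  conv_lhs => rw [← aeval_z_zbar_toComplexCoords P,
    IsHomogeneous.eq_sum_monomial (isHomogeneous_toComplexCoords hP)]
  rw [map_sum]
  refine Finset.sum_congr rfl fun p _ => ?_
  rw [map_smul, zCoeff_apply, homExp]
  congr 1
  rw [← one_mul (1 : ℂ), ← MvPolynomial.monomial_mul, ← MvPolynomial.X_pow_eq_monomial,
    ← MvPolynomial.X_pow_eq_monomial, map_mul, map_pow, map_pow, MvPolynomial.aeval_X,
    MvPolynomial.aeval_X, mul_comm]
  rfl

theorem isHomogeneous_zbar_pow_mul_z_pow (a b : ℕ) :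
    (zbar ^ a * z ^ b).IsHomogeneous (a + b) := by
  have h1 : (MvPolynomial.C Complex.I * MvPolynomial.X 1 : Pol).IsHomogeneous 1 := by
    simpa using! (MvPolynomial.isHomogeneous_C (Fin 2) Complex.I).mul
      (MvPolynomial.isHomogeneous_X ℂ (1 : Fin 2))
  have hx := MvPolynomial.isHomogeneous_X ℂ (0 : Fin 2)
  simpa using! ((hx.sub h1).pow a).mul ((hx.add h1).pow b)

/-! ### Spinors in the complex coordinates -/

/-- The Schwartz function that multiplies `z̄ ^ a * z ^ b` in a spinor. -/
def spinorCoeff (a b : ℕ) : Spinor →ₗ[ℂ] 𝓢(ℝ, ℂ) :=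
  (TensorProduct.lid ℂ 𝓢(ℝ, ℂ)).toLinearMap ∘ₗ LinearMap.rTensor 𝓢(ℝ, ℂ) (zCoeff a b)

theorem spinorCoeff_tmul (a b : ℕ) (P : Pol) (g : 𝓢(ℝ, ℂ)) :
    spinorCoeff a b (P ⊗ₜ g) = zCoeff a b P • g := by
  simp [spinorCoeff]

theorem coeffAt_tmul (m : Fin 2 →₀ ℕ) (P : Pol) (g : 𝓢(ℝ, ℂ)) :
    coeffAt m (P ⊗ₜ g) = P.coeff m • g := by
  simp [coeffAt]

theorem tmul_mem_homogeneousSpinors {h : ℕ} {P : Pol} (hP : P.IsHomogeneous h) (g : 𝓢(ℝ, ℂ)) :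
    P ⊗ₜ[ℂ] g ∈ homogeneousSpinors h :=
  ⟨(⟨P, hP⟩ : MvPolynomial.homogeneousSubmodule (Fin 2) ℂ h) ⊗ₜ g, rfl⟩

theorem homogeneousSpinors_induction {h : ℕ}
    {motive : (f : Spinor) → f ∈ homogeneousSpinors h → Prop}
    (zero : motive 0 (Submodule.zero_mem _))
    (add : ∀ f g hf hg, motive f hf → motive g hg → motive (f + g) (Submodule.add_mem _ hf hg))
    (tmul : ∀ (P : Pol) (g : 𝓢(ℝ, ℂ)) (hP : P.IsHomogeneous h),
      motive (P ⊗ₜ g) (tmul_mem_homogeneousSpinors hP g))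
    {f : Spinor} (hf : f ∈ homogeneousSpinors h) : motive f hf := by
  obtain ⟨t, rfl⟩ := hf
  induction t using TensorProduct.induction_on with
  | zero => simpa using! zero
  | tmul P g => exact tmul P g P.2
  | add s t hs ht =>
    simp only [map_add]
    exact add _ _ ⟨s, rfl⟩ ⟨t, rfl⟩ hs ht

theorem eq_sum_spinorCoeff {h : ℕ} {f : Spinor} (hf : f ∈ homogeneousSpinors h) :
    f = ∑ p ∈ Finset.range (h + 1), (zbar ^ (h - p) * z ^ p) ⊗ₜ spinorCoeff (h - p) p f := by
  induction hf using homogeneousSpinors_induction with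
  | zero => simp
  | add f g _ _ hf hg =>
    simp only [map_add, TensorProduct.tmul_add, Finset.sum_add_distrib]
    rw [← hf, ← hg]
  | tmul P g hP =>
    simp only [spinorCoeff_tmul, ← TensorProduct.smul_tmul, ← TensorProduct.sum_tmul]
    rw [← IsHomogeneous.eq_sum_zCoeff hP]

/-- On homogeneous spinors the coefficients in `z` and `z̄` are finite linear combinations of the
coefficients in `x` and `y`. -/
theorem spinorCoeff_eq_sum_coeffAt {h : ℕ} {f : Spinor} (hf : f ∈ homogeneousSpinors h)
    (a b : ℕ) : spinorCoeff a b f = ∑ p ∈ Finset.range (h + 1),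
      zCoeff a b (MvPolynomial.monomial (homExp h p) 1) • coeffAt (homExp h p) f := by
  induction hf using homogeneousSpinors_induction with
  | zero => simp
  | add f g _ _ hf hg => simp only [map_add, smul_add, Finset.sum_add_distrib, hf, hg]
  | tmul P g hP =>
    rw [spinorCoeff_tmul]
    conv_lhs => rw [IsHomogeneous.eq_sum_monomial hP, map_sum, Finset.sum_smul]
    refine Finset.sum_congr rfl fun p _ => ?_
    rw [coeffAt_tmul, map_smul, smul_smul, smul_eq_mul, mul_comm]

theorem pderiv_zero_zbar_pow_mul_z_pow (a b : ℕ) :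
    MvPolynomial.pderiv 0 (zbar ^ a * z ^ b) =
      (a : ℂ) • (zbar ^ (a - 1) * z ^ b) + (b : ℂ) • (zbar ^ a * z ^ (b - 1)) := by
  have h1 : MvPolynomial.pderiv 0 zbar = 1 := by simp [zbar]
  have h2 : MvPolynomial.pderiv 0 z = 1 := by simp [z]
  rw [MvPolynomial.pderiv_mul, MvPolynomial.pderiv_pow, MvPolynomial.pderiv_pow, h1, h2]
  simp only [Nat.cast_smul_eq_nsmul, nsmul_eq_mul]
  ring

theorem pderiv_one_zbar_pow_mul_z_pow (a b : ℕ) :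
    MvPolynomial.pderiv 1 (zbar ^ a * z ^ b) =
      Complex.I • ((b : ℂ) • (zbar ^ a * z ^ (b - 1)) - (a : ℂ) • (zbar ^ (a - 1) * z ^ b)) := by
  have h1 : MvPolynomial.pderiv 1 zbar = -MvPolynomial.C Complex.I := by
    simp [zbar]
  have h2 : MvPolynomial.pderiv 1 z = MvPolynomial.C Complex.I := by
    simp [z]
  rw [MvPolynomial.pderiv_mul, MvPolynomial.pderiv_pow, MvPolynomial.pderiv_pow, h1, h2]
  simp only [Nat.cast_smul_eq_nsmul, nsmul_eq_mul, MvPolynomial.smul_eq_C_mul]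
  ring

theorem diracOp_tmul (P : Pol) (g : 𝓢(ℝ, ℂ)) :
    diracOp (P ⊗ₜ g) = MvPolynomial.pderiv 1 P ⊗ₜ (Complex.I • mulQ g) -
      MvPolynomial.pderiv 0 P ⊗ₜ derivQ g := rfl

/-- The symplectic Dirac operator is `-(q + ∂_q) ∂_z + (q - ∂_q) ∂_z̄`. -/
theorem diracOp_zbar_pow_mul_z_pow_tmul (a b : ℕ) (g : 𝓢(ℝ, ℂ)) :
    diracOp ((zbar ^ a * z ^ b) ⊗ₜ g) =
      (a : ℂ) • ((zbar ^ (a - 1) * z ^ b) ⊗ₜ[ℂ] raiseQ g) -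
        (b : ℂ) • ((zbar ^ a * z ^ (b - 1)) ⊗ₜ[ℂ] lowerQ g) := by
  rw [diracOp_tmul, pderiv_zero_zbar_pow_mul_z_pow, pderiv_one_zbar_pow_mul_z_pow, raiseQ, lowerQ]
  simp only [LinearMap.sub_apply, LinearMap.add_apply, TensorProduct.tmul_sub,
    TensorProduct.tmul_add, TensorProduct.sub_tmul, TensorProduct.add_tmul, smul_sub,
    ← TensorProduct.smul_tmul', TensorProduct.tmul_smul, smul_smul]
  have hI : ∀ c : ℂ, Complex.I * (Complex.I * c) = -c := fun c => by
    rw [← mul_assoc, Complex.I_mul_I, neg_one_mul]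
  simp only [hI]
  module

/-- The coefficients of a homogeneous solution of the symplectic Dirac equation are coupled by
`(h - p) (q - ∂_q) f_p = (p + 1) (q + ∂_q) f_{p+1}`. -/
theorem raiseQ_spinorCoeff_eq {h p : ℕ} {f : Spinor} (hf : f ∈ homogeneousSpinors h)
    (hD : diracOp f = 0) (hp : p < h) :
    ((h - p : ℕ) : ℂ) • raiseQ (spinorCoeff (h - p) p f) =
      ((p + 1 : ℕ) : ℂ) • lowerQ (spinorCoeff (h - (p + 1)) (p + 1) f) := by
  have h1 := congrArg (spinorCoeff (h - p - 1) p) hD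
  rw [eq_sum_spinorCoeff hf, map_sum, map_sum, map_zero] at h1
  simp only [diracOp_zbar_pow_mul_z_pow_tmul, map_sub, map_smul, spinorCoeff_tmul,
    zCoeff_zbar_pow_mul_z_pow, Finset.sum_sub_distrib] at h1
  rw [Finset.sum_eq_single p, Finset.sum_eq_single (p + 1)] at h1
  · rw [← sub_eq_zero]
    convert h1 using 2
    · simp
    · rw [if_pos ⟨by omega, by omega⟩, one_smul]
  · intro q hq hne
    rcases Nat.eq_zero_or_pos q with rfl | hq0
    · simp
    · rw [if_neg (by omega), zero_smul, smul_zero]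
  · intro hn
    exact absurd (Finset.mem_range.2 (by omega)) hn
  · intro q hq hne
    rw [if_neg (by omega), zero_smul, smul_zero]
  · intro hn
    exact absurd (Finset.mem_range.2 (by omega)) hn

/-! ### Parity -/

theorem reflectQ_reflectQ (g : 𝓢(ℝ, ℂ)) : reflectQ (reflectQ g) = g := by
  ext q
  simp [reflectQ_apply]

theorem reflectQ_mulQ (g : 𝓢(ℝ, ℂ)) : reflectQ (mulQ g) = -mulQ (reflectQ g) := by
  ext q
  change reflectQ (mulQ g) q = -(mulQ (reflectQ g) q)
  simp [reflectQ_apply, mulQ_apply]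

theorem reflectQ_derivQ (g : 𝓢(ℝ, ℂ)) : reflectQ (derivQ g) = -derivQ (reflectQ g) := by
  ext q
  change deriv g (-q) = -(deriv (fun x => g (-x)) q)
  rw [deriv_comp_neg, neg_neg]

theorem hermitePoly_eval_neg (k : ℕ) (q : ℝ) :
    (hermitePoly k).eval (-q) = (-1) ^ k * (hermitePoly k).eval q := by
  induction k using Nat.strong_induction_on with
  | _ k ih =>
    match k with
    | 0 => simp [hermitePoly]
    | 1 => simp [hermitePoly]
    | k + 2 =>
      have h : hermitePoly (k + 2) = 2 * Polynomial.X * hermitePoly (k + 1) -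
        Polynomial.derivative (hermitePoly (k + 1)) := rfl
      rw [h, derivative_hermitePoly_succ]
      simp only [Polynomial.eval_sub, Polynomial.eval_mul, Polynomial.eval_X,
        Polynomial.eval_ofNat, Polynomial.eval_smul, smul_eq_mul, ih k (by omega),
        ih (k + 1) (by omega)]
      ring

theorem reflectQ_hermiteFun (k : ℕ) : reflectQ (hermiteFun k) = (-1 : ℂ) ^ k • hermiteFun k := by
  ext q
  change hermiteFun k (-q) = (-1 : ℂ) ^ k * hermiteFun k q
  rw [hermiteFun_apply', hermiteFun_apply', hermitePoly_eval_neg, neg_sq]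
  push_cast
  ring

theorem hermiteCoeff_reflectQ (k : ℕ) (g : 𝓢(ℝ, ℂ)) :
    hermiteCoeff k (reflectQ g) = (-1) ^ k * hermiteCoeff k g := by
  rw [hermiteCoeff, ← pairCLM_smul_left, ← reflectQ_hermiteFun, pairCLM_apply, pairCLM_apply]
  have := integral_neg_eq_self (fun q => reflectQ (hermiteFun k) q * g q) volume
  rw [← this]
  simp [reflectQ_apply]

theorem spinorCoeff_reflectQ (a b : ℕ) (f : Spinor) :
    spinorCoeff a b (LinearMap.lTensor Pol reflectQ f) = reflectQ (spinorCoeff a b f) := by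
  induction f using TensorProduct.induction_on with
  | zero => simp
  | tmul P g => simp [spinorCoeff_tmul]
  | add f g hf hg => simp only [map_add, hf, hg]

theorem hermiteCoeff_spinorCoeff_of_mem_oddSpinors {f : Spinor} (hf : f ∈ oddSpinors) (a b : ℕ)
    {j : ℕ} (hj : Even j) : hermiteCoeff j (spinorCoeff a b f) = 0 := by
  have h1 : LinearMap.lTensor Pol reflectQ f = -f := eq_neg_of_add_eq_zero_left hf
  have h2 := hermiteCoeff_reflectQ j (spinorCoeff a b f)
  rw [← spinorCoeff_reflectQ, h1, map_neg, map_neg, hj.neg_one_pow, one_mul] at h2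
  exact self_eq_neg.1 h2.symm

theorem hermiteCoeff_spinorCoeff_of_mem_evenSpinors {f : Spinor} (hf : f ∈ evenSpinors) (a b : ℕ)
    {j : ℕ} (hj : Odd j) : hermiteCoeff j (spinorCoeff a b f) = 0 := by
  have h1 : LinearMap.lTensor Pol reflectQ f = f := sub_eq_zero.1 hf
  have h2 := hermiteCoeff_reflectQ j (spinorCoeff a b f)
  rw [← spinorCoeff_reflectQ, h1, hj.neg_one_pow, neg_one_mul] at h2
  exact self_eq_neg.1 h2

theorem tmul_hermiteFun_mem_oddSpinors (P : Pol) {j : ℕ} (hj : Odd j) :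
    P ⊗ₜ[ℂ] hermiteFun j ∈ oddSpinors := by
  change LinearMap.lTensor Pol reflectQ _ + P ⊗ₜ[ℂ] hermiteFun j = 0
  rw [LinearMap.lTensor_tmul, reflectQ_hermiteFun, hj.neg_one_pow, neg_one_smul,
    TensorProduct.tmul_neg, neg_add_cancel]

theorem tmul_hermiteFun_mem_evenSpinors (P : Pol) {j : ℕ} (hj : Even j) :
    P ⊗ₜ[ℂ] hermiteFun j ∈ evenSpinors := by
  change LinearMap.lTensor Pol reflectQ _ - P ⊗ₜ[ℂ] hermiteFun j = 0
  rw [LinearMap.lTensor_tmul, reflectQ_hermiteFun, hj.neg_one_pow, one_smul, sub_self]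

/-! ### The explicit solutions -/

/-- The coefficient `√((j-1)!! / j!!) (h choose p)` of `ψⱼ z̄^(h-p) z^p` in the explicit solutions.
For `j = 0` the truncated `j - 1` is `0`, which gives the value required by `(-1)!! = 1`. -/
def solutionWeight (h p j : ℕ) : ℝ :=
  Real.sqrt (((j - 1)‼ : ℝ) / (j‼ : ℝ)) * (h.choose p : ℝ)

theorem solutionWeight_ne_zero {h p : ℕ} (hp : p ≤ h) (j : ℕ) : solutionWeight h p j ≠ 0 := by
  have h1 : (0 : ℝ) < ((j - 1)‼ : ℝ) := by exact_mod_cast Nat.doubleFactorial_pos _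
  have h2 : (0 : ℝ) < (j‼ : ℝ) := by exact_mod_cast Nat.doubleFactorial_pos _
  have h3 : (0 : ℝ) < (h.choose p : ℝ) := by exact_mod_cast Nat.choose_pos hp
  rw [solutionWeight]
  positivity

theorem solutionWeight_succ (h p j : ℕ) :
    ((p + 1 : ℕ) : ℝ) * Real.sqrt (2 * ((j + 1 : ℕ) + 1)) * solutionWeight h (p + 1) (j + 2) =
      ((h - p : ℕ) : ℝ) * Real.sqrt (2 * (j + 1 : ℕ)) * solutionWeight h p j := by
  have h1 : (0 : ℝ) < ((j - 1)‼ : ℝ) := by exact_mod_cast Nat.doubleFactorial_pos _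
  have h2 : (0 : ℝ) < (j‼ : ℝ) := by exact_mod_cast Nat.doubleFactorial_pos _
  have h3 : ((j + 1)‼ : ℝ) = (j + 1) * ((j - 1)‼ : ℝ) := by
    exact_mod_cast Nat.doubleFactorial_add_one j
  have h4 : ((j + 2)‼ : ℝ) = (j + 2) * (j‼ : ℝ) := by
    exact_mod_cast Nat.doubleFactorial_add_two j
  have h5 : Real.sqrt (2 * ((j + 1 : ℕ) + 1)) * Real.sqrt (((j + 2 - 1)‼ : ℝ) / ((j + 2)‼ : ℝ)) =
      Real.sqrt (2 * (j + 1 : ℕ)) * Real.sqrt (((j - 1)‼ : ℝ) / (j‼ : ℝ)) := by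
    rw [← Real.sqrt_mul (by positivity), ← Real.sqrt_mul (by positivity),
      show j + 2 - 1 = j + 1 by omega, h3, h4]
    congr 1
    push_cast
    have : (j : ℝ) + 2 ≠ 0 := by positivity
    field_simp
    ring
  have h6 : ((p + 1 : ℕ) : ℝ) * (h.choose (p + 1) : ℝ) = ((h - p : ℕ) : ℝ) * (h.choose p : ℝ) := by
    have := Nat.choose_succ_right_eq h p
    have h7 : (h.choose (p + 1) : ℝ) * ((p + 1 : ℕ) : ℝ) =
        (h.choose p : ℝ) * ((h - p : ℕ) : ℝ) := by
      exact_mod_cast this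
    linarith
  rw [solutionWeight, solutionWeight]
  linear_combination (((h - p : ℕ) : ℝ) * (h.choose p : ℝ)) * h5 +
    (Real.sqrt (2 * ((j + 1 : ℕ) + 1)) * Real.sqrt (((j + 2 - 1)‼ : ℝ) / ((j + 2)‼ : ℝ))) * h6

/-- The term of degree `p` in `z` of `chainSolution h l`. -/
def chainTerm (h : ℕ) (l : ℤ) (p : ℕ) : Spinor :=
  if 0 ≤ l + 2 * p then
    (solutionWeight h p (l + 2 * p).toNat : ℂ) •
      ((zbar ^ (h - p) * z ^ p) ⊗ₜ[ℂ] hermiteFun (l + 2 * p).toNat)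
  else 0

/-- The odd and the even solutions, put into one family: `oddSolution h k` is the member with
`l = 2 k + 1` and `evenSolution h k` that with `l = 2 k`. The coefficient of `z̄^(h-p) z^p` is a
multiple of `ψ_{l + 2 p}`, and is absent when `l + 2 p` is negative. -/
def chainSolution (h : ℕ) (l : ℤ) : Spinor := ∑ p ∈ Finset.range (h + 1), chainTerm h l p

theorem oddSolution_eq (h k : ℕ) : oddSolution h k = chainSolution h (2 * k + 1) := by
  refine Finset.sum_congr rfl fun p _ => ?_
  have h1 : ((2 * k + 1 + 2 * p : ℤ)).toNat = 2 * k + 2 * p + 1 := by omega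
  rw [chainTerm, if_pos (by positivity), h1]
  rfl

theorem evenSolution_eq (h : ℕ) (k : ℤ) : evenSolution h k = chainSolution h (2 * k) := by
  rw [evenSolution, chainSolution]
  have hsub : Finset.Icc (-k).toNat h ⊆ Finset.range (h + 1) := by
    intro p hp
    rw [Finset.mem_Icc] at hp
    exact Finset.mem_range.2 (by omega)
  rw [← Finset.sum_subset hsub]
  · refine Finset.sum_congr rfl fun p hp => ?_
    rw [Finset.mem_Icc] at hp
    have h1 : (2 * k + 2 * p).toNat = 2 * (k + p).toNat := by omega
    rw [chainTerm, if_pos (by omega), h1]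
    rfl
  · intro p hp hn
    rw [Finset.mem_range] at hp
    rw [Finset.mem_Icc] at hn
    rw [chainTerm, if_neg (by omega)]

theorem chainSolution_mem_homogeneousSpinors (h : ℕ) (l : ℤ) :
    chainSolution h l ∈ homogeneousSpinors h := by
  refine Submodule.sum_mem _ fun p hp => ?_
  rw [chainTerm]
  split_ifs
  · refine Submodule.smul_mem _ _ (tmul_mem_homogeneousSpinors ?_ _)
    have := isHomogeneous_zbar_pow_mul_z_pow (h - p) p
    rwa [Nat.sub_add_cancel (Nat.lt_succ_iff.1 (Finset.mem_range.1 hp))] at this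
  · exact Submodule.zero_mem _

theorem chainSolution_mem_oddSpinors (h : ℕ) {l : ℤ} (hl : Odd l) :
    chainSolution h l ∈ oddSpinors := by
  refine Submodule.sum_mem _ fun p _ => ?_
  rw [chainTerm]
  split_ifs
  · refine Submodule.smul_mem _ _ (tmul_hermiteFun_mem_oddSpinors _ ?_)
    rw [Int.odd_iff] at hl
    rw [Nat.odd_iff]
    omega
  · exact Submodule.zero_mem _

theorem chainSolution_mem_evenSpinors (h : ℕ) {l : ℤ} (hl : Even l) :
    chainSolution h l ∈ evenSpinors := by
  refine Submodule.sum_mem _ fun p _ => ?_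
  rw [chainTerm]
  split_ifs
  · refine Submodule.smul_mem _ _ (tmul_hermiteFun_mem_evenSpinors _ ?_)
    rw [Int.even_iff] at hl
    rw [Nat.even_iff]
    omega
  · exact Submodule.zero_mem _

/-- The spinors `chainSolution h l` solve the symplectic Dirac equation, by telescoping. For a
negative odd `l` this fails, as the chain would have to start with a term in `ψ₁`. -/
theorem diracOp_chainSolution (h : ℕ) {l : ℤ} (hl : Even l ∨ 0 ≤ l) :
    diracOp (chainSolution h l) = 0 := by
  -- `V p` is the image under `(q - ∂_q) ∂_z̄` of the term of degree `p`, and `U p` that under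
  -- `(q + ∂_q) ∂_z`
  set V : ℕ → Spinor := fun p => if 0 ≤ l + 2 * p then
    ((solutionWeight h p (l + 2 * p).toNat * (((h - p : ℕ) : ℝ) *
      Real.sqrt (2 * ((l + 2 * p).toNat + 1))) : ℝ) : ℂ) •
      ((zbar ^ (h - p - 1) * z ^ p) ⊗ₜ[ℂ] hermiteFun ((l + 2 * p).toNat + 1)) else 0 with hV
  set U : ℕ → Spinor := fun p => if 0 ≤ l + 2 * p then
    ((solutionWeight h p (l + 2 * p).toNat * ((p : ℝ) *
      Real.sqrt (2 * (l + 2 * p).toNat)) : ℝ) : ℂ) •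
      ((zbar ^ (h - p) * z ^ (p - 1)) ⊗ₜ[ℂ] hermiteFun ((l + 2 * p).toNat - 1)) else 0 with hU
  have hD : ∀ p, diracOp (chainTerm h l p) = V p - U p := by
    intro p
    simp only [chainTerm, hV, hU]
    split_ifs
    · rw [map_smul, diracOp_zbar_pow_mul_z_pow_tmul, raiseQ_hermiteFun, lowerQ_hermiteFun]
      simp only [TensorProduct.tmul_smul, smul_sub, smul_smul]
      push_cast
      rfl
    · simp
  have hU0 : U 0 = 0 := by simp [hU]
  have hVh : V h = 0 := by simp [hV]
  have hVU : ∀ p, V p = U (p + 1) := by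
    intro p
    simp only [hV, hU]
    by_cases h0 : 0 ≤ l + 2 * p
    · have h1 : (l + 2 * (p + 1 : ℕ)).toNat = (l + 2 * p).toNat + 2 := by push_cast; omega
      rw [if_pos h0, if_pos (by push_cast; omega), h1]
      have h2 := solutionWeight_succ h p (l + 2 * p).toNat
      congr 2
      push_cast at h2 ⊢
      rw [show (2 : ℝ) * (((l + 2 * p).toNat : ℝ) + 1 + 1) =
        2 * (((l + 2 * p).toNat : ℝ) + 2) by ring]
        at h2
      norm_cast at h2 ⊢
      linarith
    · rw [if_neg h0]
      split_ifs with h3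
      · have h1 : (l + 2 * (p + 1 : ℕ)).toNat = 0 := by
          rcases hl with hl | hl
          · rw [Int.even_iff] at hl
            push_cast at h3 ⊢
            omega
          · omega
        rw [h1]
        simp
      · rfl
  rw [chainSolution, map_sum]
  simp_rw [hD]
  rw [Finset.sum_sub_distrib, Finset.sum_range_succ, Finset.sum_range_succ', hU0, hVh, add_zero,
    add_zero, sub_eq_zero]
  exact Finset.sum_congr rfl fun p _ => hVU p

/-! ### The topology on spinors -/

/-- The Hermite coefficient of index `j` of the component of `f` along `z̄^(h-p) z^p`. -/
def matrixCoeff (h p j : ℕ) : Spinor →ₗ[ℂ] ℂ :=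
  (hermiteCoeff j).toLinearMap ∘ₗ spinorCoeff (h - p) p

theorem matrixCoeff_apply (h p j : ℕ) (f : Spinor) :
    matrixCoeff h p j f = hermiteCoeff j (spinorCoeff (h - p) p f) := rfl

theorem continuous_coeffAt (m : Fin 2 →₀ ℕ) : Continuous (coeffAt m) :=
  (continuous_apply m).comp (continuous_induced_dom (f := fun f (m : Fin 2 →₀ ℕ) => coeffAt m f))

theorem continuousAdd_spinor : ContinuousAdd Spinor := by
  refine ⟨continuous_induced_rng.2 (continuous_pi fun m => ?_)⟩
  have : (fun x : Spinor × Spinor => coeffAt m (x.1 + x.2)) =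
      fun x => coeffAt m x.1 + coeffAt m x.2 := funext fun x => map_add _ _ _
  change Continuous fun x : Spinor × Spinor => coeffAt m (x.1 + x.2)
  rw [this]
  exact ((continuous_coeffAt m).comp continuous_fst).add
    ((continuous_coeffAt m).comp continuous_snd)

theorem continuous_tmul (P : Pol) : Continuous fun g : 𝓢(ℝ, ℂ) => (P ⊗ₜ[ℂ] g : Spinor) := by
  refine continuous_induced_rng.2 (continuous_pi fun m => ?_)
  change Continuous fun g : 𝓢(ℝ, ℂ) => coeffAt m (P ⊗ₜ[ℂ] g)
  simp only [coeffAt_tmul]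
  exact continuous_const_smul _

theorem continuous_matrixCoeff {h : ℕ} {M : Submodule ℂ Spinor} (hM : M ≤ homogeneousSpinors h)
    (p j : ℕ) : Continuous fun f : M => matrixCoeff h p j f := by
  refine (hermiteCoeff j).continuous.comp ?_
  have : (fun f : M => spinorCoeff (h - p) p (f : Spinor)) = fun f : M =>
      ∑ q ∈ Finset.range (h + 1), zCoeff (h - p) p (MvPolynomial.monomial (homExp h q) 1) •
        coeffAt (homExp h q) (f : Spinor) :=
    funext fun f => spinorCoeff_eq_sum_coeffAt (hM f.2) _ _
  rw [this]
  exact continuous_finsetSum _ fun q _ =>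
    (continuous_const_smul _).comp ((continuous_coeffAt _).comp continuous_subtype_val)

/-! ### Expansion in the explicit solutions -/

/-- The smallest `p` with `0 ≤ l + 2 p`, where the chain of `chainSolution h l` starts. -/
def chainStart (l : ℤ) : ℕ := ((1 - l) / 2).toNat

theorem chainStart_nonneg (l : ℤ) : 0 ≤ l + 2 * chainStart l := by
  rw [chainStart]
  omega

theorem chainStart_le {l : ℤ} {p : ℕ} (hp : 0 ≤ l + 2 * p) : chainStart l ≤ p := by
  rw [chainStart]
  omega

/-- The coefficient of `chainSolution h l` in the expansion of a solution, read off from the first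
term of the chain. -/
def chainCoeff (h : ℕ) (l : ℤ) : Spinor →ₗ[ℂ] ℂ :=
  ((solutionWeight h (chainStart l) (l + 2 * chainStart l).toNat : ℂ))⁻¹ •
    matrixCoeff h (chainStart l) (l + 2 * chainStart l).toNat

theorem chainCoeff_apply (h : ℕ) (l : ℤ) (f : Spinor) :
    chainCoeff h l f = (solutionWeight h (chainStart l) (l + 2 * chainStart l).toNat : ℂ)⁻¹ *
      matrixCoeff h (chainStart l) (l + 2 * chainStart l).toNat f := rfl

theorem matrixCoeff_chainSolution {h p : ℕ} (hp : p ≤ h) (j : ℕ) (l : ℤ) :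
    matrixCoeff h p j (chainSolution h l) =
      if (j : ℤ) = l + 2 * p then (solutionWeight h p j : ℂ) else 0 := by
  rw [chainSolution, map_sum, Finset.sum_eq_single p]
  · rw [chainTerm]
    split_ifs with h1 h2 h2
    · rw [map_smul, matrixCoeff_apply, spinorCoeff_tmul, zCoeff_zbar_pow_mul_z_pow,
        if_pos ⟨rfl, rfl⟩, one_smul, hermiteCoeff_hermiteFun, if_pos (by omega), ← h2]
      simp
    · rw [map_smul, matrixCoeff_apply, spinorCoeff_tmul, map_smul, hermiteCoeff_hermiteFun,
        if_neg (by omega), smul_zero, smul_zero]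
    · omega
    · rw [map_zero]
  · intro q _ hq
    rw [chainTerm]
    split_ifs
    · rw [map_smul, matrixCoeff_apply, spinorCoeff_tmul, zCoeff_zbar_pow_mul_z_pow,
        if_neg (fun e => hq e.2), zero_smul, map_zero, smul_zero]
    · rw [map_zero]
  · intro hn
    exact absurd (Finset.mem_range.2 (Nat.lt_succ_of_le hp)) hn

theorem chainCoeff_chainSolution {h : ℕ} {l : ℤ} (hl : chainStart l ≤ h) (l' : ℤ) :
    chainCoeff h l (chainSolution h l') = if l = l' then 1 else 0 := by
  have h0 := chainStart_nonneg l
  rw [chainCoeff_apply, matrixCoeff_chainSolution hl]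
  by_cases hll : l = l'
  · subst hll
    rw [if_pos (by omega), if_pos rfl, inv_mul_cancel₀]
    exact Complex.ofReal_ne_zero.2 (solutionWeight_ne_zero hl _)
  · rw [if_neg (by omega), if_neg hll, mul_zero]

theorem matrixCoeff_succ_eq {h p : ℕ} {f : Spinor} (hf : f ∈ homogeneousSpinors h)
    (hD : diracOp f = 0) (hp : p < h) (j : ℕ) :
    ((p + 1 : ℕ) : ℂ) * (Real.sqrt (2 * (j + 1)) * matrixCoeff h (p + 1) (j + 1) f) =
      ((h - p : ℕ) : ℂ) * (Real.sqrt (2 * j) * matrixCoeff h p (j - 1) f) := by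
  have h1 := congrArg (hermiteCoeff j) (raiseQ_spinorCoeff_eq hf hD hp)
  rw [map_smul, map_smul, hermiteCoeff_raiseQ, hermiteCoeff_lowerQ] at h1
  exact h1.symm

/-- The equation has no term that could balance `ψ₁` in a component with `p ≥ 1`: its image under
`q + ∂_q` is a multiple of `ψ₀`, and the range of `q - ∂_q` is orthogonal to `ψ₀`. -/
theorem matrixCoeff_succ_one_eq_zero {h p : ℕ} {f : Spinor} (hf : f ∈ homogeneousSpinors h)
    (hD : diracOp f = 0) (hp : p < h) : matrixCoeff h (p + 1) 1 f = 0 := by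
  have h1 := matrixCoeff_succ_eq hf hD hp 0
  simp only [Nat.cast_zero, mul_zero, Real.sqrt_zero, Complex.ofReal_zero, zero_mul] at h1
  have h2 : ((p + 1 : ℕ) : ℂ) ≠ 0 := Nat.cast_ne_zero.2 (Nat.succ_ne_zero p)
  have h3 : (Real.sqrt (2 * (0 + 1)) : ℂ) ≠ 0 := Complex.ofReal_ne_zero.2 (by positivity)
  exact ((mul_eq_zero.1 ((mul_eq_zero.1 h1).resolve_left h2))).resolve_left h3

/-- Along a chain the Hermite coefficients of a solution are determined by the first one. -/
theorem matrixCoeff_eq_chainCoeff_mul {h : ℕ} {f : Spinor} (hf : f ∈ homogeneousSpinors h)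
    (hD : diracOp f = 0) {l : ℤ} {p : ℕ} (hl : chainStart l ≤ p) (hp : p ≤ h) :
    matrixCoeff h p (l + 2 * p).toNat f =
      chainCoeff h l f * solutionWeight h p (l + 2 * p).toNat := by
  have h0 := chainStart_nonneg l
  induction p, hl using Nat.le_induction with
  | base =>
    have : (solutionWeight h (chainStart l) (l + 2 * chainStart l).toNat : ℂ) ≠ 0 :=
      Complex.ofReal_ne_zero.2 (solutionWeight_ne_zero hp _)
    rw [chainCoeff_apply]
    field_simp
  | succ p hlp ih =>
    have h1 : (l + 2 * (p + 1 : ℕ)).toNat = (l + 2 * p).toNat + 2 := by push_cast; omega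
    have h2 := matrixCoeff_succ_eq hf hD (Nat.lt_of_succ_le hp) ((l + 2 * p).toNat + 1)
    rw [add_tsub_cancel_right, ih (by omega)] at h2
    have h3 := congrArg (fun r : ℝ => (r : ℂ)) (solutionWeight_succ h p (l + 2 * p).toNat)
    simp only [Complex.ofReal_mul, Complex.ofReal_natCast] at h3
    rw [h1]
    have h4 : ((p + 1 : ℕ) : ℂ) ≠ 0 := Nat.cast_ne_zero.2 (Nat.succ_ne_zero p)
    have h5 : (Real.sqrt (2 * (((l + 2 * p).toNat + 1 : ℕ) + 1)) : ℂ) ≠ 0 :=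
      Complex.ofReal_ne_zero.2 (by positivity)
    refine mul_left_cancel₀ h5 (mul_left_cancel₀ h4 ?_)
    rw [show (l + 2 * p).toNat + 2 = (l + 2 * p).toNat + 1 + 1 from rfl] at h3 ⊢
    linear_combination h2 - chainCoeff h l f * h3

/-- The Hermite expansions of the components of a solution, with the terms sorted by chains. -/
theorem hasSum_chainSolution {h : ℕ} {f : Spinor} (hf : f ∈ homogeneousSpinors h)
    (hD : diracOp f = 0) : HasSum (fun l : ℤ => chainCoeff h l f • chainSolution h l) f := by
  have := continuousAdd_spinor
  have hterm : ∀ p ∈ Finset.range (h + 1), HasSum (fun l : ℤ => chainCoeff h l f • chainTerm h l p)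
      ((zbar ^ (h - p) * z ^ p) ⊗ₜ[ℂ] spinorCoeff (h - p) p f) := by
    intro p hp
    have hp' : p ≤ h := Nat.lt_succ_iff.1 (Finset.mem_range.1 hp)
    have h1 := (hasSum_hermite (spinorCoeff (h - p) p f)).map
      (TensorProduct.mk ℂ Pol 𝓢(ℝ, ℂ) (zbar ^ (h - p) * z ^ p)) (continuous_tmul _)
    -- the index `j` of `ψⱼ` and the index `l` of the chain are related by `j = l + 2 p`
    have hinj : Function.Injective fun j : ℕ => (j : ℤ) - 2 * p := fun a b hab => by
      have : (a : ℤ) - 2 * p = b - 2 * p := hab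
      omega
    refine (hinj.hasSum_iff ?_).1 (h1.congr_fun fun j => ?_)
    · intro l hl
      have : ¬ 0 ≤ l + 2 * p := fun hl0 => hl ⟨(l + 2 * p).toNat, by
        change (((l + 2 * p).toNat : ℕ) : ℤ) - 2 * p = l
        omega⟩
      rw [chainTerm, if_neg this, smul_zero]
    · have h2 := matrixCoeff_eq_chainCoeff_mul hf hD (l := (j : ℤ) - 2 * p) (p := p)
        (chainStart_le (by omega)) hp'
      simp only [sub_add_cancel, Int.toNat_natCast, matrixCoeff_apply] at h2
      simp only [Function.comp_apply, chainTerm, sub_add_cancel, Int.toNat_natCast, map_smul,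
        TensorProduct.mk_apply]
      rw [if_pos (by positivity), h2, smul_smul]
  have hsum := hasSum_sum hterm
  rw [← eq_sum_spinorCoeff hf] at hsum
  simpa only [chainSolution, Finset.smul_sum] using hsum

/-- A family of solutions `chainSolution h (l i)` in a space `M` of solutions is a topological basis
of `M` if the coefficients of the members of `M` along the other chains vanish. -/
theorem isTopologicalBasis_chainSolution {ι : Type*} {h : ℕ} {M : Submodule ℂ Spinor} {l : ι → ℤ}
    (hM : M ≤ homogeneousSpinors h) (hD : M ≤ LinearMap.ker diracOp) (hl : Function.Injective l)
    (hstart : ∀ i, chainStart (l i) ≤ h) (hmem : ∀ i, chainSolution h (l i) ∈ M)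
    (hzero : ∀ f ∈ M, ∀ m ∉ Set.range l, chainCoeff h m f = 0) :
    IsTopologicalBasis M fun i => chainSolution h (l i) := by
  have hcont : ∀ i, Continuous fun f : M => chainCoeff h (l i) (f : Spinor) := fun i => by
    simp only [chainCoeff_apply]
    exact continuous_const.mul (continuous_matrixCoeff hM _ _)
  refine ⟨hmem, fun i => ⟨chainCoeff h (l i) ∘ₗ M.subtype, hcont i⟩, fun f a => ?_⟩
  change _ ↔ ∀ i, a i = chainCoeff h (l i) (f : Spinor)
  have hexp : HasSum (fun i => chainCoeff h (l i) (f : Spinor) • chainSolution h (l i))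
      (f : Spinor) := by
    have h1 := hasSum_chainSolution (hM f.2) (hD f.2)
    rw [← hl.hasSum_iff fun m hm => by rw [hzero f f.2 m hm, zero_smul]] at h1
    exact h1
  constructor
  · intro hsum i
    classical
    have h1 : HasSum (fun j => (⟨a j • chainSolution h (l j), M.smul_mem _ (hmem j)⟩ : M)) f :=
      (Topology.IsInducing.subtypeVal.hasSum_iff (g := M.subtype) _ _).1 hsum
    have h2 := h1.map (chainCoeff h (l i) ∘ₗ M.subtype) (hcont i)
    have h3 : ∀ j, (chainCoeff h (l i) ∘ₗ M.subtype)
        (⟨a j • chainSolution h (l j), M.smul_mem _ (hmem j)⟩ : M) = if j = i then a i else 0 := by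
      intro j
      change chainCoeff h (l i) (a j • chainSolution h (l j)) = _
      rw [map_smul, chainCoeff_chainSolution (hstart i), smul_eq_mul, mul_ite, mul_one, mul_zero]
      by_cases hij : j = i
      · rw [hij, if_pos rfl, if_pos rfl]
      · rw [if_neg (fun e => hij (hl e).symm), if_neg hij]
    exact (hasSum_ite_eq i (a i)).unique (h2.congr_fun fun j => (h3 j).symm)
  · intro ha
    simpa only [ha] using hexp

theorem chainCoeff_eq_zero_of_lt {h : ℕ} {l : ℤ} (hl : h < chainStart l) (f : Spinor) :
    chainCoeff h l f = 0 := by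
  rw [chainCoeff_apply, solutionWeight, Nat.choose_eq_zero_of_lt hl]
  simp

theorem isTopologicalBasis_oddSolution (h : ℕ) :
    IsTopologicalBasis (homogeneousSpinors h ⊓ oddMonogenics) (fun k : ℕ => oddSolution h k) := by
  have hstart : ∀ k : ℕ, chainStart (2 * k + 1) = 0 := fun k => by rw [chainStart]; omega
  simp only [oddSolution_eq]
  refine isTopologicalBasis_chainSolution (l := fun k : ℕ => 2 * (k : ℤ) + 1) inf_le_left
    (inf_le_right.trans inf_le_left) (fun a b hab => ?_) (fun k => ?_) (fun k => ?_)
    (fun f hf m hm => ?_)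
  · simp only at hab
    omega
  · rw [hstart]
    exact Nat.zero_le h
  · exact ⟨chainSolution_mem_homogeneousSpinors _ _,
      diracOp_chainSolution _ (Or.inr (by positivity)),
      chainSolution_mem_oddSpinors _ ⟨k, rfl⟩⟩
  · have h0 := chainStart_nonneg m
    rw [chainCoeff_apply]
    rcases Int.even_or_odd m with hpar | hpar
    · rw [matrixCoeff_apply, hermiteCoeff_spinorCoeff_of_mem_oddSpinors hf.2.2, mul_zero]
      rw [Int.even_iff] at hpar
      rw [Nat.even_iff]
      omega
    · -- the chain of a negative odd `m` starts with `ψ₁` at some `p ≥ 1`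
      rw [Int.odd_iff] at hpar
      have hneg : m < 0 := by
        by_contra hm0
        refine hm ⟨(m / 2).toNat, ?_⟩
        simp only
        omega
      obtain ⟨p, hp⟩ : ∃ p, chainStart m = p + 1 :=
        Nat.exists_eq_succ_of_ne_zero (by rw [chainStart]; omega)
      by_cases hph : p < h
      · have h1 : (m + 2 * chainStart m).toNat = 1 := by rw [chainStart]; omega
        rw [h1, hp, matrixCoeff_succ_one_eq_zero hf.1 hf.2.1 hph, mul_zero]
      · rw [← chainCoeff_apply, chainCoeff_eq_zero_of_lt (by omega)]

theorem isTopologicalBasis_evenSolution (h : ℕ) :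
    IsTopologicalBasis (homogeneousSpinors h ⊓ evenMonogenics)
      (fun k : {k : ℤ // -(h : ℤ) ≤ k} => evenSolution h k) := by
  simp only [evenSolution_eq]
  refine isTopologicalBasis_chainSolution (l := fun k : {k : ℤ // -(h : ℤ) ≤ k} => 2 * (k : ℤ))
    inf_le_left (inf_le_right.trans inf_le_left) (fun a b hab => ?_) (fun k => ?_) (fun k => ?_)
    (fun f hf m hm => ?_)
  · simp only at hab
    exact Subtype.ext (by omega)
  · have := k.2
    rw [chainStart]
    omega
  · exact ⟨chainSolution_mem_homogeneousSpinors _ _,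
      diracOp_chainSolution _ (Or.inl (even_two_mul _)),
      chainSolution_mem_evenSpinors _ (even_two_mul _)⟩
  · have h0 := chainStart_nonneg m
    rcases Int.even_or_odd m with hpar | hpar
    · rw [Int.even_iff] at hpar
      refine chainCoeff_eq_zero_of_lt ?_ f
      by_contra hlt
      exact hm ⟨⟨m / 2, by omega⟩, by simp only; omega⟩
    · rw [chainCoeff_apply, matrixCoeff_apply, hermiteCoeff_spinorCoeff_of_mem_evenSpinors hf.2.2,
        mul_zero]
      rw [Int.odd_iff] at hpar
      rw [Nat.odd_iff]
      omega

/-! ### Decomposition by homogeneity -/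

/-- The projection of a spinor to its part of homogeneity `h`. -/
def homogeneousPart (h : ℕ) : Spinor →ₗ[ℂ] Spinor :=
  LinearMap.rTensor 𝓢(ℝ, ℂ) (MvPolynomial.homogeneousComponent h)

theorem homogeneousPart_tmul (h : ℕ) (P : Pol) (g : 𝓢(ℝ, ℂ)) :
    homogeneousPart h (P ⊗ₜ g) = MvPolynomial.homogeneousComponent h P ⊗ₜ g := rfl

theorem homogeneousPart_mem (h : ℕ) (f : Spinor) : homogeneousPart h f ∈ homogeneousSpinors h := by
  induction f using TensorProduct.induction_on with
  | zero => simp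
  | tmul P g =>
    exact tmul_mem_homogeneousSpinors (MvPolynomial.homogeneousComponent_isHomogeneous h P) g
  | add f g hf hg => rw [map_add]; exact Submodule.add_mem _ hf hg

theorem homogeneousPart_of_mem {h : ℕ} (k : ℕ) {f : Spinor} (hf : f ∈ homogeneousSpinors h) :
    homogeneousPart k f = if k = h then f else 0 := by
  induction hf using homogeneousSpinors_induction with
  | zero => simp
  | add f g _ _ hf hg =>
    rw [map_add, hf, hg]
    split_ifs
    · rfl
    · rw [add_zero]
  | tmul P g hP =>
    rw [homogeneousPart_tmul, MvPolynomial.homogeneousComponent_of_mem hP]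
    split_ifs
    · rfl
    · rw [TensorProduct.zero_tmul]

theorem exists_eq_sum_homogeneousPart (f : Spinor) :
    ∃ n, ∀ m ≥ n, f = ∑ h ∈ Finset.range m, homogeneousPart h f := by
  induction f using TensorProduct.induction_on with
  | zero => exact ⟨0, fun m _ => by simp⟩
  | tmul P g =>
    refine ⟨P.totalDegree + 1, fun m hm => ?_⟩
    simp only [homogeneousPart_tmul, ← TensorProduct.sum_tmul]
    congr 1
    conv_lhs => rw [← MvPolynomial.sum_homogeneousComponent P]
    refine Finset.sum_subset (Finset.range_mono hm) fun h _ hh => ?_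
    rw [Finset.mem_range] at hh
    exact MvPolynomial.homogeneousComponent_eq_zero h P (by omega)
  | add f g hf hg =>
    obtain ⟨n, hn⟩ := hf
    obtain ⟨n', hn'⟩ := hg
    refine ⟨max n n', fun m hm => ?_⟩
    simp only [map_add, Finset.sum_add_distrib]
    rw [← hn m (le_trans (le_max_left _ _) hm), ← hn' m (le_trans (le_max_right _ _) hm)]

theorem iSupIndep_homogeneousSpinors : iSupIndep homogeneousSpinors := by
  intro h
  rw [Submodule.disjoint_def]
  intro f hf hf'
  have hle : (⨆ (k : ℕ) (_ : k ≠ h), homogeneousSpinors k) ≤ LinearMap.ker (homogeneousPart h) := by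
    refine iSup₂_le fun k hk f hf => ?_
    rw [LinearMap.mem_ker, homogeneousPart_of_mem h hf, if_neg hk.symm]
  have h1 := homogeneousPart_of_mem h hf
  rw [if_pos rfl] at h1
  rw [← h1]
  exact hle hf'

theorem homogeneousComponent_pderiv (i : Fin 2) (h : ℕ) (P : Pol) :
    MvPolynomial.homogeneousComponent h (MvPolynomial.pderiv i P) =
      MvPolynomial.pderiv i (MvPolynomial.homogeneousComponent (h + 1) P) := by
  ext m
  rw [MvPolynomial.coeff_homogeneousComponent, MvPolynomial.coeff_pderiv, MvPolynomial.coeff_pderiv,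
    MvPolynomial.coeff_homogeneousComponent, map_add, Finsupp.degree_single]
  simp only [add_left_inj]
  split_ifs <;> simp

theorem homogeneousPart_diracOp (h : ℕ) (f : Spinor) :
    homogeneousPart h (diracOp f) = diracOp (homogeneousPart (h + 1) f) := by
  induction f using TensorProduct.induction_on with
  | zero => simp
  | tmul P g =>
    rw [homogeneousPart_tmul, diracOp_tmul, diracOp_tmul, map_sub, homogeneousPart_tmul,
      homogeneousPart_tmul, homogeneousComponent_pderiv, homogeneousComponent_pderiv]
  | add f g hf hg => simp only [map_add, hf, hg]

theorem diracOp_homogeneousPart_zero (f : Spinor) : diracOp (homogeneousPart 0 f) = 0 := by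
  induction f using TensorProduct.induction_on with
  | zero => simp
  | tmul P g =>
    rw [homogeneousPart_tmul, diracOp_tmul, MvPolynomial.homogeneousComponent_zero,
      MvPolynomial.pderiv_C, MvPolynomial.pderiv_C]
    simp
  | add f g hf hg => simp only [map_add, hf, hg, add_zero]

theorem homogeneousPart_mem_ker_diracOp (h : ℕ) {f : Spinor} (hf : f ∈ LinearMap.ker diracOp) :
    homogeneousPart h f ∈ LinearMap.ker diracOp := by
  rw [LinearMap.mem_ker] at hf ⊢
  cases h with
  | zero => exact diracOp_homogeneousPart_zero f
  | succ h => rw [← homogeneousPart_diracOp, hf, map_zero]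

theorem homogeneousPart_reflectQ (h : ℕ) (f : Spinor) :
    homogeneousPart h (LinearMap.lTensor Pol reflectQ f) =
      LinearMap.lTensor Pol reflectQ (homogeneousPart h f) := by
  induction f using TensorProduct.induction_on with
  | zero => simp
  | tmul P g => rfl
  | add f g hf hg => simp only [map_add, hf, hg]

theorem homogeneousPart_mem_oddMonogenics (h : ℕ) {f : Spinor} (hf : f ∈ oddMonogenics) :
    homogeneousPart h f ∈ oddMonogenics := by
  refine ⟨homogeneousPart_mem_ker_diracOp h hf.1, ?_⟩
  have h1 : LinearMap.lTensor Pol reflectQ f + f = 0 := hf.2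
  change LinearMap.lTensor Pol reflectQ _ + homogeneousPart h f = 0
  rw [← homogeneousPart_reflectQ, ← map_add, h1, map_zero]

theorem homogeneousPart_mem_evenMonogenics (h : ℕ) {f : Spinor} (hf : f ∈ evenMonogenics) :
    homogeneousPart h f ∈ evenMonogenics := by
  refine ⟨homogeneousPart_mem_ker_diracOp h hf.1, ?_⟩
  have h1 : LinearMap.lTensor Pol reflectQ f - f = 0 := hf.2
  change LinearMap.lTensor Pol reflectQ _ - homogeneousPart h f = 0
  rw [← homogeneousPart_reflectQ, ← map_sub, h1, map_zero]

/-- A subspace that is stable under the projections to the homogeneous parts is the direct sum of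
its homogeneous subspaces. -/
theorem iSupIndep_and_iSup_eq_of_homogeneousPart_mem {M : Submodule ℂ Spinor}
    (hM : ∀ (h : ℕ), ∀ f ∈ M, homogeneousPart h f ∈ M) :
    iSupIndep (fun h : ℕ => homogeneousSpinors h ⊓ M) ∧
      (⨆ h : ℕ, homogeneousSpinors h ⊓ M) = M := by
  refine ⟨iSupIndep_homogeneousSpinors.mono fun h => inf_le_left,
    le_antisymm (iSup_le fun h => inf_le_right) fun f hf => ?_⟩
  obtain ⟨n, hn⟩ := exists_eq_sum_homogeneousPart f
  rw [hn n le_rfl]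
  exact Submodule.sum_mem _ fun h _ =>
    Submodule.mem_iSup_of_mem h ⟨homogeneousPart_mem h f, hM h f hf⟩

/-! ### Decomposition by parity -/

theorem lTensor_reflectQ_lTensor_reflectQ (f : Spinor) :
    LinearMap.lTensor Pol reflectQ (LinearMap.lTensor Pol reflectQ f) = f := by
  induction f using TensorProduct.induction_on with
  | zero => simp
  | tmul P g => simp only [LinearMap.lTensor_tmul, reflectQ_reflectQ]
  | add f g hf hg => simp only [map_add, hf, hg]

/-- The symplectic Dirac operator anticommutes with the reflection of `q`. -/
theorem diracOp_lTensor_reflectQ (f : Spinor) :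
    diracOp (LinearMap.lTensor Pol reflectQ f) = -LinearMap.lTensor Pol reflectQ (diracOp f) := by
  induction f using TensorProduct.induction_on with
  | zero => simp
  | tmul P g =>
    simp only [LinearMap.lTensor_tmul, diracOp_tmul, map_sub, map_smul, reflectQ_mulQ,
      reflectQ_derivQ, TensorProduct.tmul_neg, smul_neg]
    abel
  | add f g hf hg => simp only [map_add, hf, hg, neg_add]

theorem disjoint_oddMonogenics_evenMonogenics : Disjoint oddMonogenics evenMonogenics := by
  rw [Submodule.disjoint_def]
  intro f hf hf'
  have h1 : LinearMap.lTensor Pol reflectQ f = -f := eq_neg_of_add_eq_zero_left hf.2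
  have h2 : LinearMap.lTensor Pol reflectQ f = f := sub_eq_zero.1 hf'.2
  have h3 : f + f = 0 := by rw [← eq_neg_iff_add_eq_zero, ← h1, h2]
  have h4 : f = (1 / 2 : ℂ) • (f + f) := by module
  exact h4.trans (by rw [h3, smul_zero])

theorem oddMonogenics_sup_evenMonogenics :
    oddMonogenics ⊔ evenMonogenics = LinearMap.ker diracOp := by
  refine le_antisymm (sup_le inf_le_left inf_le_left) fun f hf => ?_
  set r := LinearMap.lTensor Pol reflectQ f with hr
  have hr' : LinearMap.lTensor Pol reflectQ r = f := lTensor_reflectQ_lTensor_reflectQ f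
  have hrD : r ∈ LinearMap.ker diracOp := by
    rw [LinearMap.mem_ker] at hf ⊢
    rw [hr, diracOp_lTensor_reflectQ, hf, map_zero, neg_zero]
  refine Submodule.mem_sup.2 ⟨(1 / 2 : ℂ) • (f - r), ⟨?_, ?_⟩, (1 / 2 : ℂ) • (f + r), ⟨?_, ?_⟩, ?_⟩
  · exact Submodule.smul_mem _ _ (Submodule.sub_mem _ hf hrD)
  · change LinearMap.lTensor Pol reflectQ _ + (1 / 2 : ℂ) • (f - r) = 0
    rw [map_smul, map_sub, hr', ← hr]
    module
  · exact Submodule.smul_mem _ _ (Submodule.add_mem _ hf hrD)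
  · change LinearMap.lTensor Pol reflectQ _ - (1 / 2 : ℂ) • (f + r) = 0
    rw [map_smul, map_add, hr', ← hr]
    module
  · module

end SymplecticDirac

end

theorem mainTheorem6 :
    (∀ h : ℕ, IsTopologicalBasis (homogeneousSpinors h ⊓ oddMonogenics)
      (fun k : ℕ => oddSolution h k)) ∧
    (∀ h : ℕ, IsTopologicalBasis (homogeneousSpinors h ⊓ evenMonogenics)
      (fun k : {k : ℤ // -(h : ℤ) ≤ k} => evenSolution h k)) ∧
    (iSupIndep (fun h : ℕ => homogeneousSpinors h ⊓ oddMonogenics) ∧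
      (⨆ h : ℕ, homogeneousSpinors h ⊓ oddMonogenics) = oddMonogenics) ∧
    (iSupIndep (fun h : ℕ => homogeneousSpinors h ⊓ evenMonogenics) ∧
      (⨆ h : ℕ, homogeneousSpinors h ⊓ evenMonogenics) = evenMonogenics) ∧
    (Disjoint oddMonogenics evenMonogenics ∧
      oddMonogenics ⊔ evenMonogenics = LinearMap.ker diracOp) := by
  refine ⟨isTopologicalBasis_oddSolution, isTopologicalBasis_evenSolution, ?_, ?_, ?_⟩
  · exact iSupIndep_and_iSup_eq_of_homogeneousPart_mem fun h _ =>
      homogeneousPart_mem_oddMonogenics h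
  · exact iSupIndep_and_iSup_eq_of_homogeneousPart_mem fun h _ =>
      homogeneousPart_mem_evenMonogenics h
  · exact ⟨disjoint_oddMonogenics_evenMonogenics, oddMonogenics_sup_evenMonogenics⟩
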